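/- Let $\lambda_b,\lambda_u,\lambda_l,\mu_b>0$. On a stationary framework $(\Omega,\mathbf P,(\theta_x)_{x\in\mathbb R^2})$ consider: a planar base station process $\Phi_b$ and a planar user process $\Phi_u$, homogeneous Poisson point processes on $\mathbb R^2$ with intensities $\lambda_b$ and $\lambda_u$; a Poisson point process $\Xi=\{(r_i,\theta_i)\}$ on the cylinder $\mathbb R\times[0,\pi)$ with intensity measure $\frac{\lambda_l}{\pi}\,dr\,d\theta$, whose points define the roads $l(r_i,\theta_i)=\{(x,y):x\cos\theta_i+y\sin\theta_i=r_i\}$; and, conditionally on the roads, independent homogeneous Poisson point processes of intensity $\mu_b$ on the roads (each road being identified with $\mathbb R$ by arc length), whose union $\Psi_b$ is the set of vehicular base stations. The processes $\Phi_b$, $\Phi_u$ and the road/vehicle system are mutually independent, and $\Phi_b,\Phi_u,\Psi_b$ are compatible with the flow $(\theta_x)$. Let $\mathbf P^0_{\Phi_u}$ be the Palm probability with respect to $\Phi_u$, and let $$R_p=\inf_{X\in\Phi_b}\|X\|,\qquad R_v=\inf_{X\in\Psi_b}\|X\|,\qquad R=\inf_{X\in\Phi_b\cup\Psi_b}\|X\|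 .$$ Then $R=\min(R_p,R_v)$, the variables $R_p$ and $R_v$ are independent under $\mathbf P^0_{\Phi_u}$, the distance $R$ from the typical planar user (at the origin) to the nearest base station is $\mathbf P^0_{\Phi_u}$-almost surely finite, and under $\mathbf P^0_{\Phi_u}$ it has the probability density $$\begin{aligned}f_R(r)={}&2\pi\lambda_b r\,e^{-\pi\lambda_b r^2}\,e^{-2\lambda_l\int_0^r\left(1-e^{-2\mu_b\sqrt{r^2-t^2}}\right)dt}\\&+e^{-\pi\lambda_b r^2-2\lambda_l\int_0^r\left(1-e^{-2\mu_b\sqrt{r^2-u^2}}\right)du}\int_0^r\frac{4\lambda_l\mu_b r\,e^{-2\mu_b\sqrt{r^2-u^2}}}{\sqrt{r^2-u^2}}\,du,\qquad r\ge 0 .\end{aligned}$$ -/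

import Mathlib

open MeasureTheory ProbabilityTheory Set
open scoped ENNReal

noncomputable section

/-- The Euclidean plane. -/
abbrev Plane : Type := EuclideanSpace ℝ (Fin 2)

/-- The cylinder `ℝ × [0, π)` that parametrizes the undirected lines of the plane. -/
abbrev Cylinder : Type := ℝ × Set.Ico (0 : ℝ) Real.pi

/-- The Lebesgue measure `dr dθ` on the cylinder. -/
def cylinderMeasure : Measure Cylinder :=
  (volume : Measure ℝ).prod (Measure.comap Subtype.val (volume : Measure ℝ))

/-! ### Point processes -/

/-- A (simple) point process on `E`: a random locally finite set of points for which the number of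
points in every Borel set is a random variable. -/
structure PointProcess (Ω E : Type*) [MeasurableSpace Ω] [PseudoMetricSpace E]
    [MeasurableSpace E] where
  /-- The set of points of the realization `ω`. -/
  points : Ω → Set E
  locallyFinite : ∀ ω B, Bornology.IsBounded B → (points ω ∩ B).Finite
  measurable_encard : ∀ B, MeasurableSet B →
    Measurable fun ω => ((points ω ∩ B).encard : ℝ≥0∞)

namespace PointProcess

variable {Ω E : Type*} [MeasurableSpace Ω] [PseudoMetricSpace E] [MeasurableSpace E]

/-- The number of points of the process in `B`. -/
def number (Φ : PointProcess Ω E) (B : Set E) (ω : Ω) : ℝ≥0∞ := ((Φ.points ω ∩ B).encard : ℝ≥0∞)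

/-- The process as a random counting measure `∑ δ_X`, the sum being over the points `X`. -/
def countingMeasure (Φ : PointProcess Ω E) (ω : Ω) : Measure E :=
  Measure.count.restrict (Φ.points ω)

theorem countingMeasure_apply (Φ : PointProcess Ω E) (ω : Ω) {B : Set E} (hB : MeasurableSet B)
    [MeasurableSingletonClass E] : Φ.countingMeasure ω B = Φ.number B ω := by
  have hc : (Φ.points ω).Countable := by
    rcases isEmpty_or_nonempty E with h | ⟨⟨x⟩⟩
    · exact Set.to_countable _
    · have : Φ.points ω = ⋃ n : ℕ, Φ.points ω ∩ Metric.ball x n := by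
        rw [← Set.inter_iUnion, Metric.iUnion_ball_nat, Set.inter_univ]
      rw [this]
      exact Set.countable_iUnion fun n => (Φ.locallyFinite ω _ Metric.isBounded_ball).countable
  rw [countingMeasure, Measure.restrict_apply hB,
    Measure.count_apply (hB.inter hc.measurableSet), number, Set.inter_comm]

theorem measurable_countingMeasure (Φ : PointProcess Ω E) [MeasurableSingletonClass E] :
    Measurable Φ.countingMeasure := by
  refine Measure.measurable_of_measurable_coe _ fun B hB => ?_
  simp only [Φ.countingMeasure_apply _ hB]
  exact Φ.measurable_encard B hB

/-- `Φ` is, under `P`, a Poisson point process with intensity measure `Λ`: the number of points in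
a Borel set `B` with `Λ B < ∞` has the Poisson law of mean `Λ B`, and the numbers of points in
pairwise disjoint Borel sets are independent. -/
structure IsPoisson (Φ : PointProcess Ω E) (Λ : Measure E) (P : Measure Ω) : Prop where
  law_number : ∀ B, MeasurableSet B → Λ B < ∞ →
    P.map (Φ.number B) = (poissonMeasure (Λ B).toNNReal).map (fun n : ℕ => (n : ℝ≥0∞))
  indep_number : ∀ (n : ℕ) (B : Fin n → Set E), (∀ i, MeasurableSet (B i)) →
    Pairwise (Function.onFun Disjoint B) → iIndepFun (fun i => Φ.number (B i)) P

/-- The σ-algebra generated by a point process. -/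
@[reducible]
def sigmaAlgebra (Φ : PointProcess Ω E) : MeasurableSpace Ω :=
  MeasurableSpace.comap Φ.countingMeasure inferInstance

end PointProcess

/-! ### Stationary frameworks and Palm probabilities -/

/-- `(Ω, P, θ)` is a stationary framework over the plane: `θ` is a measurable flow on `Ω` indexed
by the translations of the plane, and it leaves `P` invariant. -/
structure StationaryFramework {Ω : Type*} [MeasurableSpace Ω] (P : Measure Ω)
    (θ : Plane → Ω → Ω) : Prop where
  measurable : Measurable fun p : Plane × Ω => θ p.1 p.2
  zero : ∀ ω, θ 0 ω = ω
  add : ∀ x y ω, θ (x + y) ω = θ x (θ y ω)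
  measurePreserving : ∀ x, MeasurePreserving (θ x) P P

/-- Compatibility of a random set of points with the flow `θ`: the realization at `θ x ω` is the
realization at `ω`, seen from the point `x`. -/
def FlowCompatible {Ω : Type*} (θ : Plane → Ω → Ω) (S : Ω → Set Plane) : Prop :=
  ∀ x ω, S (θ x ω) = (fun y => y - x) '' S ω

/-- The unit square `[0, 1)²`. -/
def unitSquare : Set Plane := {x | ∀ i, x i ∈ Set.Ico (0 : ℝ) 1}

/-- The intensity of a stationary point process: its mean number of points in the unit square. -/
def spatialIntensity {Ω : Type*} [MeasurableSpace Ω] (P : Measure Ω)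
    (Φ : PointProcess Ω Plane) : ℝ≥0∞ := ∫⁻ ω, Φ.number unitSquare ω ∂P

/-- The Palm probability `P⁰_Φ` of a point process `Φ` on a stationary framework:
`P⁰_Φ(A) = λ⁻¹ E[∑_{X ∈ Φ ∩ [0,1)²} 1_A(θ_X ω)]`, where `λ` is the intensity of `Φ`. -/
def palm {Ω : Type*} [MeasurableSpace Ω] (P : Measure Ω) (θ : Plane → Ω → Ω)
    (Φ : PointProcess Ω Plane) : Measure Ω :=
  (spatialIntensity P Φ)⁻¹ •
    P.bind fun ω => ((Φ.countingMeasure ω).restrict unitSquare).map fun x => θ x ω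

theorem measurableSet_unitSquare : MeasurableSet unitSquare := by
  have : unitSquare = ⋂ i : Fin 2, (fun x : Plane => x i) ⁻¹' Set.Ico (0 : ℝ) 1 := by
    ext x; simp [unitSquare]
  rw [this]
  exact MeasurableSet.iInter fun i => measurableSet_Ico.preimage (by fun_prop)

theorem isBounded_unitSquare : Bornology.IsBounded unitSquare := by
  refine (Metric.isBounded_iff_subset_closedBall 0).2 ⟨2, fun x hx => ?_⟩
  have h0 := hx 0
  have h1 := hx 1
  rw [Metric.mem_closedBall, dist_zero_right, EuclideanSpace.norm_eq, Fin.sum_univ_two]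
  rw [Real.sqrt_le_left (by norm_num)]
  simp only [Real.norm_eq_abs, sq_abs]
  nlinarith [h0.1, h0.2, h1.1, h1.2]

/-- On a stationary framework `palm` is given by the usual formula. -/
theorem palm_apply {Ω : Type*} [MeasurableSpace Ω] {P : Measure Ω} {θ : Plane → Ω → Ω}
    (h : StationaryFramework P θ) (Φ : PointProcess Ω Plane) {A : Set Ω} (hA : MeasurableSet A) :
    palm P θ Φ A = (spatialIntensity P Φ)⁻¹ *
      ∫⁻ ω, (({X ∈ Φ.points ω | X ∈ unitSquare ∧ θ X ω ∈ A}).encard : ℝ≥0∞) ∂P := by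
  have hsec : ∀ ω, Measurable fun x => θ x ω := fun ω =>
    h.measurable.comp (measurable_id.prodMk measurable_const)
  have hset : ∀ ω (B : Set Ω), MeasurableSet B →
      ((Φ.countingMeasure ω).restrict unitSquare).map (fun x => θ x ω) B
        = (({X ∈ Φ.points ω | X ∈ unitSquare ∧ θ X ω ∈ B}).encard : ℝ≥0∞) := by
    intro ω B hB
    rw [Measure.map_apply (hsec ω) hB, Measure.restrict_apply (hsec ω hB),
      Φ.countingMeasure_apply ω ((hsec ω hB).inter measurableSet_unitSquare), PointProcess.number]
    congr 2
    ext X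
    simp only [mem_inter_iff, mem_preimage, Set.mem_ofPred_eq]
    tauto
  let κ : Kernel Ω Plane :=
    ⟨fun ω => (Φ.countingMeasure ω).restrict unitSquare,
      by
        refine Measure.measurable_of_measurable_coe _ fun B hB => ?_
        simp only [Measure.restrict_apply hB,
          Φ.countingMeasure_apply _ (hB.inter measurableSet_unitSquare)]
        exact Φ.measurable_encard _ (hB.inter measurableSet_unitSquare)⟩
  have hfin : ∀ ω, IsFiniteMeasure (κ ω) := fun ω => by
    refine ⟨?_⟩
    change (Φ.countingMeasure ω).restrict unitSquare univ < ∞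
    rw [Measure.restrict_apply_univ, Φ.countingMeasure_apply ω measurableSet_unitSquare,
      PointProcess.number]
    simpa using Φ.locallyFinite ω _ isBounded_unitSquare
  have hmeas : Measurable fun ω =>
      ((Φ.countingMeasure ω).restrict unitSquare).map fun x => θ x ω := by
    refine Measure.measurable_of_measurable_coe _ fun B hB => ?_
    have hS : MeasurableSet {p : Ω × Plane | θ p.2 p.1 ∈ B} :=
      (h.measurable.comp measurable_swap) hB
    have := Kernel.measurable_kernel_prodMk_left_of_finite (κ := κ) hS hfin
    convert this using 2 with ω
    rw [Measure.map_apply (hsec ω) hB]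
    rfl
  rw [palm, Measure.smul_apply, Measure.bind_apply hA hmeas.aemeasurable, smul_eq_mul]
  simp only [hset _ A hA]

/-! ### Lines of the plane -/

/-- The line `l(r, θ) = {(x, y) | x cos θ + y sin θ = r}`. -/
def lineOf (p : Cylinder) : Set Plane :=
  {z | z 0 * Real.cos p.2 + z 1 * Real.sin p.2 = p.1}

/-- The point of the line `l(r, θ)` with abscissa `t`, the abscissae being measured by arc length
from the point of the line that is closest to the origin. -/
def linePoint (p : Cylinder) (t : ℝ) : Plane :=
  !₂[p.1 * Real.cos p.2 - t * Real.sin p.2, p.1 * Real.sin p.2 + t * Real.cos p.2]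

theorem range_linePoint (p : Cylinder) : range (linePoint p) = lineOf p := by
  have hcs := Real.sin_sq_add_cos_sq (p.2 : ℝ)
  ext z
  constructor
  · rintro ⟨t, rfl⟩
    simp only [lineOf, linePoint, Set.mem_ofPred_eq, Matrix.cons_val_zero,
      Matrix.cons_val_one]
    linear_combination p.1 * hcs
  · intro hz
    refine ⟨z 1 * Real.cos p.2 - z 0 * Real.sin p.2, ?_⟩
    simp only [lineOf, Set.mem_ofPred_eq] at hz
    ext i
    fin_cases i
    · simp [linePoint]
      rw [← hz]; linear_combination z 0 * hcs
    · simp [linePoint]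
      rw [← hz]; linear_combination z 1 * hcs

/-! ### The network -/

/-- A cellular network on the stationary framework `(Ω, P, θ)`, with planar base stations of
intensity `lamB`, planar users of intensity `lamU`, roads given by a Poisson line process of
parameter `lamL`, and vehicular base stations of intensity `muB` on each road. -/
structure VehicularNetwork {Ω : Type*} [MeasurableSpace Ω] (P : Measure Ω) (θ : Plane → Ω → Ω)
    (lamB lamU lamL muB : ℝ) where
  /-- The planar base stations. -/
  Φb : PointProcess Ω Plane
  /-- The planar users. -/
  Φu : PointProcess Ω Plane
  /-- The point process on the cylinder that produces the roads. -/
  Ξ : PointProcess Ω Cylinder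
  /-- A measurable numbering of the points of `Ξ`. -/
  road : ℕ → Ω → Cylinder
  /-- The vehicular base stations on the `i`-th road, as a point process on `ℝ`. -/
  φ : ℕ → PointProcess Ω ℝ
  framework : StationaryFramework P θ
  poisson_Φb : Φb.IsPoisson (ENNReal.ofReal lamB • volume) P
  poisson_Φu : Φu.IsPoisson (ENNReal.ofReal lamU • volume) P
  poisson_Ξ : Ξ.IsPoisson (ENNReal.ofReal (lamL / Real.pi) • cylinderMeasure) P
  measurable_road : ∀ i, Measurable (road i)
  injective_road : ∀ ω, Function.Injective fun i => road i ω
  range_road : ∀ ω, range (fun i => road i ω) = Ξ.points ω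
  poisson_φ : ∀ i, (φ i).IsPoisson (ENNReal.ofReal muB • volume) P
  /-- The processes on the roads are independent of each other. -/
  indep_φ : iIndep (fun i => (φ i).sigmaAlgebra) P
  /-- The planar base stations, the planar users, the roads, and the family of the processes on the
  roads are mutually independent. -/
  indep : iIndep ![Φb.sigmaAlgebra, Φu.sigmaAlgebra,
    MeasurableSpace.comap (fun ω i => road i ω) inferInstance,
    ⨆ i, (φ i).sigmaAlgebra] P
  compatible_Φb : FlowCompatible θ Φb.points
  compatible_Φu : FlowCompatible θ Φu.points
  /-- The vehicular base stations, as a random subset of the plane, are compatible with the flow. -/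
  compatible_Ψb : FlowCompatible θ fun ω => ⋃ i, linePoint (road i ω) '' (φ i).points ω

namespace VehicularNetwork

variable {Ω : Type*} [MeasurableSpace Ω] {P : Measure Ω} {θ : Plane → Ω → Ω}
  {lamB lamU lamL muB : ℝ}

/-- The vehicular base stations. -/
def Ψb (N : VehicularNetwork P θ lamB lamU lamL muB) (ω : Ω) : Set Plane :=
  ⋃ i, linePoint (N.road i ω) '' (N.φ i).points ω

/-- The distance from the origin to the nearest planar base station (`∞` if there is none). -/
def Rp (N : VehicularNetwork P θ lamB lamU lamL muB) (ω : Ω) : ℝ≥0∞ :=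
  ⨅ X ∈ N.Φb.points ω, ‖X‖ₑ

/-- The distance from the origin to the nearest vehicular base station (`∞` if there is none). -/
def Rv (N : VehicularNetwork P θ lamB lamU lamL muB) (ω : Ω) : ℝ≥0∞ :=
  ⨅ X ∈ N.Ψb ω, ‖X‖ₑ

/-- The distance from the origin to the nearest base station (`∞` if there is none). -/
def R (N : VehicularNetwork P θ lamB lamU lamL muB) (ω : Ω) : ℝ≥0∞ :=
  ⨅ X ∈ N.Φb.points ω ∪ N.Ψb ω, ‖X‖ₑ

end VehicularNetwork

end

noncomputable section

/-! ### Poisson variables and Poisson point processes -/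

/-- The function `x ↦ e⁻ˣ` with values in `ℝ≥0∞`, for finite `x`. -/
def expNeg (x : ℝ≥0∞) : ℝ≥0∞ := ENNReal.ofReal (Real.exp (-x.toReal))

@[simp] theorem expNeg_zero : expNeg 0 = 1 := by simp [expNeg]

theorem expNeg_le_one (x : ℝ≥0∞) : expNeg x ≤ 1 := by
  simp [expNeg]

theorem measurable_expNeg : Measurable expNeg := by
  unfold expNeg; fun_prop

theorem expNeg_sum {ι : Type*} (s : Finset ι) (f : ι → ℝ≥0∞) (h : ∀ i ∈ s, f i ≠ ∞) :
    expNeg (∑ i ∈ s, f i) = ∏ i ∈ s, expNeg (f i) := by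
  rw [expNeg, ENNReal.toReal_sum h, ← Finset.sum_neg_distrib, Real.exp_sum,
    ENNReal.ofReal_prod_of_nonneg fun i _ => (Real.exp_pos _).le]
  rfl

theorem expNeg_anti {x y : ℝ≥0∞} (hxy : x ≤ y) (hy : y ≠ ∞) : expNeg y ≤ expNeg x := by
  refine ENNReal.ofReal_le_ofReal (Real.exp_le_exp.2 (neg_le_neg ?_))
  exact ENNReal.toReal_mono hy hxy

theorem tendsto_expNeg {α : Type*} {l : Filter α} {u : α → ℝ≥0∞} {x : ℝ≥0∞} (hx : x ≠ ∞)
    (hu : Filter.Tendsto u l (nhds x)) : Filter.Tendsto (fun a => expNeg (u a)) l (nhds (expNeg x)) :=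
  ENNReal.tendsto_ofReal ((Real.continuous_exp.tendsto _).comp
    ((ENNReal.tendsto_toReal hx).comp hu).neg)

theorem lintegral_poissonMeasure (r : NNReal) (f : ℕ → ℝ≥0∞) :
    ∫⁻ n, f n ∂poissonMeasure r =
      ∑' n : ℕ, ENNReal.ofReal (Real.exp (-r) * r ^ n / n.factorial) * f n := by
  simp [poissonMeasure, lintegral_sum_measure]

theorem lintegral_cast_poissonMeasure (r : NNReal) :
    ∫⁻ n : ℕ, (n : ℝ≥0∞) ∂poissonMeasure r = r := by
  rw [lintegral_poissonMeasure, tsum_eq_zero_add' ENNReal.summable]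
  have h : ∀ n : ℕ, ENNReal.ofReal (Real.exp (-r) * r ^ (n + 1) / (n + 1).factorial)
      * ((n + 1 : ℕ) : ℝ≥0∞) = r * ENNReal.ofReal (Real.exp (-r) * r ^ n / n.factorial) := by
    intro n
    rw [← ENNReal.ofReal_natCast, ← ENNReal.ofReal_coe_nnreal, ← ENNReal.ofReal_mul (by positivity),
      ← ENNReal.ofReal_mul (by positivity), Nat.factorial_succ]
    congr 1
    push_cast
    field_simp
    ring
  simp only [h, ENNReal.tsum_mul_left]
  rw [← ENNReal.ofReal_tsum_of_nonneg (fun n => by positivity)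
    (hasSum_one_poissonMeasure r).summable, (hasSum_one_poissonMeasure r).tsum_eq]
  simp

theorem lintegral_expNeg_poissonMeasure (r : NNReal) (y : ℝ≥0∞) :
    ∫⁻ n : ℕ, expNeg (y * n) ∂poissonMeasure r = expNeg ((1 - expNeg y) * r) := by
  rw [lintegral_poissonMeasure]
  set q : ℝ := Real.exp (-y.toReal) with hq
  have hq0 : 0 ≤ q := (Real.exp_pos _).le
  have hq1 : q ≤ 1 := by rw [hq, Real.exp_le_one_iff]; simp
  have h : ∀ n : ℕ, ENNReal.ofReal (Real.exp (-r) * r ^ n / n.factorial) * expNeg (y * n)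
      = ENNReal.ofReal (Real.exp (-r) * ((r * q) ^ n / n.factorial)) := by
    intro n
    rw [expNeg, ← ENNReal.ofReal_mul (by positivity)]
    congr 1
    rw [ENNReal.toReal_mul, ENNReal.toReal_natCast, mul_pow, hq, ← Real.exp_nat_mul]
    rw [show -(y.toReal * n) = n * -y.toReal by ring]
    ring
  have hs := (NormedSpace.expSeries_div_hasSum_exp ((r : ℝ) * q)).mul_left (Real.exp (-r))
  simp only [h]
  rw [← ENNReal.ofReal_tsum_of_nonneg (fun n => by positivity) hs.summable, hs.tsum_eq,
    ← Real.exp_eq_exp_ℝ, ← Real.exp_add, expNeg]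
  congr 2
  rw [expNeg, ← hq, ENNReal.toReal_mul, ENNReal.coe_toReal, ← ENNReal.ofReal_one,
    ← ENNReal.ofReal_sub _ hq0, ENNReal.toReal_ofReal (by linarith)]
  ring

namespace PointProcess

variable {Ω E : Type*} [MeasurableSpace Ω] [PseudoMetricSpace E] [MeasurableSpace E]

theorem number_ne_top (Φ : PointProcess Ω E) {B : Set E} (hB : Bornology.IsBounded B) (ω : Ω) :
    Φ.number B ω ≠ ∞ := by
  simpa [number] using Φ.locallyFinite ω B hB

namespace IsPoisson

variable {Φ : PointProcess Ω E} {Λ : Measure E} {P : Measure Ω}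

theorem lintegral_comp_number (h : Φ.IsPoisson Λ P) {B : Set E} (hB : MeasurableSet B)
    (hfin : Λ B < ∞) {f : ℝ≥0∞ → ℝ≥0∞} (hf : Measurable f) :
    ∫⁻ ω, f (Φ.number B ω) ∂P = ∫⁻ n : ℕ, f n ∂poissonMeasure (Λ B).toNNReal := by
  have hm : Measurable (Φ.number B) := Φ.measurable_encard B hB
  rw [← lintegral_map hf hm, h.law_number B hB hfin, lintegral_map hf (by fun_prop)]

theorem lintegral_number (h : Φ.IsPoisson Λ P) {B : Set E} (hB : MeasurableSet B)
    (hfin : Λ B < ∞) : ∫⁻ ω, Φ.number B ω ∂P = Λ B := by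
  refine (h.lintegral_comp_number hB hfin measurable_id).trans ?_
  simp [lintegral_cast_poissonMeasure, hfin.ne]

theorem lintegral_expNeg_number (h : Φ.IsPoisson Λ P) {B : Set E} (hB : MeasurableSet B)
    (hfin : Λ B < ∞) (y : ℝ≥0∞) :
    ∫⁻ ω, expNeg (y * Φ.number B ω) ∂P = expNeg ((1 - expNeg y) * Λ B) := by
  rw [h.lintegral_comp_number hB hfin (f := fun x => expNeg (y * x))
    (measurable_expNeg.comp (by fun_prop)), lintegral_expNeg_poissonMeasure,
    ENNReal.coe_toNNReal hfin.ne]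

theorem measure_number_eq_zero (h : Φ.IsPoisson Λ P) {B : Set E} (hB : MeasurableSet B)
    (hfin : Λ B < ∞) : P {ω | Φ.number B ω = 0} = expNeg (Λ B) := by
  have hm : Measurable (Φ.number B) := Φ.measurable_encard B hB
  have : {ω | Φ.number B ω = 0} = Φ.number B ⁻¹' {0} := rfl
  rw [this, ← Measure.map_apply hm (measurableSet_singleton _), h.law_number B hB hfin,
    Measure.map_apply (by fun_prop) (measurableSet_singleton _)]
  have h0 : (fun n : ℕ => (n : ℝ≥0∞)) ⁻¹' {0} = {0} := by ext; simp
  rw [h0, poissonMeasure_singleton]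
  simp [expNeg, ENNReal.toReal]

/-- The Laplace functional of a Poisson process at a simple function. -/
theorem lintegral_expNeg_simpleFunc [MeasurableSingletonClass E] (h : Φ.IsPoisson Λ P) {B : Set E}
    (hBb : Bornology.IsBounded B) (hfin : Λ B < ∞) (s : SimpleFunc E ℝ≥0∞)
    (hs : ∀ x, s x ≠ ∞) (hsB : ∀ x, x ∉ B → s x = 0) :
    ∫⁻ ω, expNeg (∫⁻ x, s x ∂Φ.countingMeasure ω) ∂P
      = expNeg (∫⁻ x, (1 - expNeg (s x)) ∂Λ) := by
  have hsub : ∀ y, y ≠ 0 → s ⁻¹' {y} ⊆ B := fun y hy x hx => by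
    by_contra hxB
    exact hy ((hsB x hxB ▸ hx : (0 : ℝ≥0∞) = y).symm)
  have hyfin : ∀ y ∈ s.range, y ≠ ∞ := fun y hy => by
    obtain ⟨x, rfl⟩ := SimpleFunc.mem_range.1 hy
    exact hs x
  have hmeas : ∀ y, MeasurableSet (s ⁻¹' {y}) := fun y => s.measurableSet_fiber y
  have hΛ : ∀ y, y ≠ 0 → Λ (s ⁻¹' {y}) < ∞ := fun y hy =>
    (measure_mono (hsub y hy)).trans_lt hfin
  have hleft : ∀ ω, expNeg (∫⁻ x, s x ∂Φ.countingMeasure ω)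
      = ∏ y : s.range, expNeg (y.1 * Φ.number (s ⁻¹' {y.1}) ω) := by
    intro ω
    rw [Finset.prod_coe_sort s.range fun y => expNeg (y * Φ.number (s ⁻¹' {y}) ω),
      SimpleFunc.lintegral_eq_lintegral, SimpleFunc.lintegral, ← expNeg_sum]
    · congr 1
      refine Finset.sum_congr rfl fun y _ => ?_
      rw [Φ.countingMeasure_apply ω (hmeas y)]
    · intro y hy
      rcases eq_or_ne y 0 with rfl | hy0
      · simp
      · exact ENNReal.mul_ne_top (hyfin y hy) (Φ.number_ne_top (hBb.subset (hsub y hy0)) ω)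
  have hright : expNeg (∫⁻ x, (1 - expNeg (s x)) ∂Λ)
      = ∏ y : s.range, expNeg ((1 - expNeg y.1) * Λ (s ⁻¹' {y.1})) := by
    rw [Finset.prod_coe_sort s.range fun y => expNeg ((1 - expNeg y) * Λ (s ⁻¹' {y})),
      ← expNeg_sum]
    · rw [← SimpleFunc.map_lintegral (fun y => 1 - expNeg y) s, ← SimpleFunc.lintegral_eq_lintegral]
      rfl
    · intro y hy
      rcases eq_or_ne y 0 with rfl | hy0
      · simp
      · exact ENNReal.mul_ne_top (by simp) (hΛ y hy0).ne
  have hind : iIndepFun (fun y : s.range => Φ.number (s ⁻¹' {y.1})) P := by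
    have e := s.range.equivFin
    have := h.indep_number _ (fun i => s ⁻¹' {(e.symm i).1}) (fun i => hmeas _) (by
      intro i j hij
      refine Disjoint.preimage _ ?_
      rw [Set.disjoint_singleton]
      exact fun hc => hij (e.symm.injective (Subtype.ext hc)))
    simpa using this.precomp e.injective
  have hnm : ∀ y : s.range, Measurable (Φ.number (s ⁻¹' {y.1})) :=
    fun y => Φ.measurable_encard _ (hmeas _)
  simp only [hleft, hright]
  rw [lintegral_prod_eq_prod_lintegral_of_indepFun Finset.univ
    (fun (y : s.range) ω => expNeg (y.1 * Φ.number (s ⁻¹' {y.1}) ω))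
    (hind.comp (fun y x => expNeg (y.1 * x)) fun y => measurable_expNeg.comp (by fun_prop))
    (fun y => measurable_expNeg.comp ((hnm y).const_mul _))]
  refine Finset.prod_congr rfl fun y _ => ?_
  rcases eq_or_ne y.1 0 with hy0 | hy0
  · have := hind.isProbabilityMeasure
    simp [hy0]
  · exact h.lintegral_expNeg_number (hmeas _) (hΛ _ hy0) y.1

/-- The Laplace functional of a Poisson process. -/
theorem lintegral_expNeg_lintegral [MeasurableSingletonClass E] [IsProbabilityMeasure P]
    (h : Φ.IsPoisson Λ P) {B : Set E}
    (hBb : Bornology.IsBounded B) (hBm : MeasurableSet B) (hfin : Λ B < ∞) {f : E → ℝ≥0∞}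
    (hf : Measurable f) (hftop : ∀ x, f x ≠ ∞) (hfB : ∀ x, x ∉ B → f x = 0)
    (hint : ∀ ω, ∫⁻ x, f x ∂Φ.countingMeasure ω ≠ ∞) :
    ∫⁻ ω, expNeg (∫⁻ x, f x ∂Φ.countingMeasure ω) ∂P
      = expNeg (∫⁻ x, (1 - expNeg (f x)) ∂Λ) := by
  have hle : ∀ n x, SimpleFunc.eapprox f n x ≤ f x := fun n x => by
    rw [← SimpleFunc.iSup_eapprox_apply hf x]
    exact le_iSup (fun k => SimpleFunc.eapprox f k x) n
  have hstep : ∀ n, ∫⁻ ω, expNeg (∫⁻ x, SimpleFunc.eapprox f n x ∂Φ.countingMeasure ω) ∂P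
      = expNeg (∫⁻ x, (1 - expNeg (SimpleFunc.eapprox f n x)) ∂Λ) := fun n =>
    h.lintegral_expNeg_simpleFunc hBb hfin _ (fun x => (SimpleFunc.eapprox_lt_top f n x).ne)
      fun x hx => le_antisymm ((hle n x).trans (hfB x hx).le) zero_le
  have hL : Filter.Tendsto
      (fun n => ∫⁻ ω, expNeg (∫⁻ x, SimpleFunc.eapprox f n x ∂Φ.countingMeasure ω) ∂P)
      Filter.atTop (nhds (∫⁻ ω, expNeg (∫⁻ x, f x ∂Φ.countingMeasure ω) ∂P)) := by
    refine tendsto_lintegral_of_dominated_convergence (fun _ => 1) (fun n => ?_)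
      (fun n => Filter.Eventually.of_forall fun ω => expNeg_le_one _) (by simp)
      (Filter.Eventually.of_forall fun ω => ?_)
    · exact measurable_expNeg.comp ((Measure.measurable_lintegral
        (SimpleFunc.eapprox f n).measurable).comp Φ.measurable_countingMeasure)
    · refine tendsto_expNeg (hint ω) ?_
      exact lintegral_tendsto_of_tendsto_of_monotone
        (fun n => (SimpleFunc.eapprox f n).measurable.aemeasurable)
        (Filter.Eventually.of_forall fun x m n hmn => SimpleFunc.monotone_eapprox f hmn x)
        (Filter.Eventually.of_forall fun x => SimpleFunc.tendsto_eapprox hf x)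
  have hR : Filter.Tendsto
      (fun n => ∫⁻ ω, expNeg (∫⁻ x, SimpleFunc.eapprox f n x ∂Φ.countingMeasure ω) ∂P)
      Filter.atTop (nhds (expNeg (∫⁻ x, (1 - expNeg (f x)) ∂Λ))) := by
    simp only [hstep]
    refine tendsto_expNeg ?_ ?_
    · refine ne_of_lt (lt_of_le_of_lt (b := ∫⁻ x, B.indicator 1 x ∂Λ) ?_ ?_)
      · refine lintegral_mono fun x => ?_
        by_cases hx : x ∈ B
        · simp [hx]
        · simp [hx, hfB x hx]
      · rwa [lintegral_indicator_one hBm]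
    · refine lintegral_tendsto_of_tendsto_of_monotone
        (fun n => ((measurable_expNeg.comp
          (SimpleFunc.eapprox f n).measurable).const_sub 1).aemeasurable)
        (Filter.Eventually.of_forall fun x m n hmn => ?_)
        (Filter.Eventually.of_forall fun x => ?_)
      · exact tsub_le_tsub_left (expNeg_anti (SimpleFunc.monotone_eapprox f hmn x)
          (SimpleFunc.eapprox_lt_top f n x).ne) 1
      · exact ENNReal.Tendsto.sub tendsto_const_nhds
          (tendsto_expNeg (hftop x) (SimpleFunc.tendsto_eapprox hf x)) (Or.inl ENNReal.one_ne_top)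
  exact tendsto_nhds_unique hL hR

end IsPoisson
end PointProcess

/-! ### Averages over a Poisson process independent of the environment -/

namespace PointProcess

variable {Ω E : Type*} [MeasurableSpace Ω] [PseudoMetricSpace E] [MeasurableSpace E]

theorem measurable_number_sigmaAlgebra [MeasurableSingletonClass E] (Φ : PointProcess Ω E)
    {B : Set E} (hB : MeasurableSet B) : Measurable[Φ.sigmaAlgebra] (Φ.number B) := by
  have h : Φ.number B = (fun m : Measure E => m B) ∘ Φ.countingMeasure := by
    funext ω
    exact (Φ.countingMeasure_apply ω hB).symm
  rw [h]
  exact (Measure.measurable_coe hB).comp (comap_measurable _)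

theorem sigmaAlgebra_le [MeasurableSingletonClass E] (Φ : PointProcess Ω E) :
    Φ.sigmaAlgebra ≤ ‹MeasurableSpace Ω› :=
  Φ.measurable_countingMeasure.comap_le

/-- The points in a set `B`, as a kernel. -/
def restrictKernel [MeasurableSingletonClass E] (Φ : PointProcess Ω E) {B : Set E}
    (hB : MeasurableSet B) : Kernel Ω E :=
  ⟨fun ω => (Φ.countingMeasure ω).restrict B,
    by
      refine Measure.measurable_of_measurable_coe _ fun S hS => ?_
      simp only [Measure.restrict_apply hS, Φ.countingMeasure_apply _ (hS.inter hB)]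
      exact Φ.measurable_encard _ (hS.inter hB)⟩

theorem IsPoisson.lintegral_number_of_indepFun [MeasurableSingletonClass E] {Φ : PointProcess Ω E}
    {Λ : Measure E} {P : Measure Ω} [IsProbabilityMeasure P] (h : Φ.IsPoisson Λ P)
    {Z' : Type*} {mZ : MeasurableSpace Z'} {Z : Ω → Z'} (hZ : Measurable Z)
    (hind : IndepFun Φ.countingMeasure Z P) {B : Set E} (hB : MeasurableSet B)
    (hBb : Bornology.IsBounded B) (hfin : Λ B < ∞) {H : Set (E × Z')} (hH : MeasurableSet H) :
    ∫⁻ ω, Φ.number ({x | (x, Z ω) ∈ H} ∩ B) ω ∂P = ∫⁻ x in B, P {ω | (x, Z ω) ∈ H} ∂Λ := by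
  have : IsFiniteMeasure (Λ.restrict B) := ⟨by simpa using hfin⟩
  let κ := Φ.restrictKernel hB
  have hκ : ∀ ω, IsFiniteMeasure (κ ω) := fun ω => ⟨by
    change (Φ.countingMeasure ω).restrict B univ < ∞
    rw [Measure.restrict_apply_univ, Φ.countingMeasure_apply ω hB]
    exact (Φ.number_ne_top hBb ω).lt_top⟩
  have hκs : ∀ ω (S : Set E), MeasurableSet S → κ ω S = Φ.number (S ∩ B) ω := fun ω S hS => by
    change (Φ.countingMeasure ω).restrict B S = _
    rw [Measure.restrict_apply hS, Φ.countingMeasure_apply ω (hS.inter hB)]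
  have hpr : ∀ ω, Measurable fun x : E => (x, Z ω) := fun ω => by fun_prop
  have hmeas : Measurable fun ω => (κ ω).map fun x => (x, Z ω) := by
    refine Measure.measurable_of_measurable_coe _ fun S hS => ?_
    have hS' : MeasurableSet {p : Ω × E | (p.2, Z p.1) ∈ S} :=
      (measurable_snd.prodMk (hZ.comp measurable_fst)) hS
    have := Kernel.measurable_kernel_prodMk_left_of_finite (κ := κ) hS' hκ
    convert this using 2 with ω
    rw [Measure.map_apply (hpr ω) hS]
    rfl
  have hkey : (Λ.restrict B).prod (P.map Z) = P.bind fun ω => (κ ω).map fun x => (x, Z ω) := by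
    have : IsProbabilityMeasure (P.map Z) := Measure.isProbabilityMeasure_map hZ.aemeasurable
    refine Measure.prod_eq fun S T hS hT => ?_
    have hm1 : Measurable (Φ.number (S ∩ B)) := Φ.measurable_encard _ (hS.inter hB)
    rw [Measure.bind_apply (hS.prod hT) hmeas.aemeasurable]
    have hterm : ∀ ω, ((κ ω).map fun x => (x, Z ω)) (S ×ˢ T)
        = Φ.number (S ∩ B) ω * T.indicator 1 (Z ω) := by
      intro ω
      rw [Measure.map_apply (hpr ω) (hS.prod hT)]
      by_cases hω : Z ω ∈ T
      · have : (fun x => (x, Z ω)) ⁻¹' S ×ˢ T = S := by ext; simp [hω]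
        rw [this, hκs ω S hS]; simp [hω]
      · have : (fun x => (x, Z ω)) ⁻¹' S ×ˢ T = ∅ := by ext; simp [hω]
        rw [this]; simp [hω]
    have hi : Measurable (T.indicator (1 : Z' → ℝ≥0∞)) := measurable_one.indicator hT
    have hind' : IndepFun (Φ.number (S ∩ B)) (fun ω => T.indicator (1 : Z' → ℝ≥0∞) (Z ω)) P := by
      have := hind.comp (φ := fun m : Measure E => m (S ∩ B)) (ψ := T.indicator (1 : Z' → ℝ≥0∞))
        (Measure.measurable_coe (hS.inter hB)) hi
      rwa [show (fun m : Measure E => m (S ∩ B)) ∘ Φ.countingMeasure = Φ.number (S ∩ B) from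
        funext fun ω => Φ.countingMeasure_apply ω (hS.inter hB)] at this
    simp only [hterm]
    have := lintegral_mul_eq_lintegral_mul_lintegral_of_indepFun (μ := P) hm1 (hi.comp hZ) hind'
    simp only [Pi.mul_apply] at this
    rw [show (fun ω => Φ.number (S ∩ B) ω * T.indicator 1 (Z ω)) =
      fun ω => Φ.number (S ∩ B) ω * (T.indicator (1 : Z' → ℝ≥0∞) ∘ Z) ω from rfl, this,
      h.lintegral_number (hS.inter hB) ((measure_mono inter_subset_right).trans_lt hfin),
      Measure.restrict_apply hS]
    congr 1
    change ∫⁻ ω, T.indicator 1 (Z ω) ∂P = _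
    rw [← lintegral_map hi hZ, lintegral_indicator_one hT]
  calc ∫⁻ ω, Φ.number ({x | (x, Z ω) ∈ H} ∩ B) ω ∂P
      = (P.bind fun ω => (κ ω).map fun x => (x, Z ω)) H := by
        rw [Measure.bind_apply hH hmeas.aemeasurable]
        refine lintegral_congr fun ω => ?_
        rw [Measure.map_apply (hpr ω) hH, hκs ω _ (hpr ω hH)]
        rfl
    _ = ∫⁻ x in B, P {ω | (x, Z ω) ∈ H} ∂Λ := by
        rw [← hkey, Measure.prod_apply hH]
        refine lintegral_congr fun x => ?_
        rw [Measure.map_apply hZ (measurable_prodMk_left hH)]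
        rfl

end PointProcess

/-! ### Measurability of distances to random sets -/

theorem exists_mem_ball_denseSeq {E : Type*} [PseudoMetricSpace E]
    [TopologicalSpace.SeparableSpace E] [Nonempty E] (x : E) {δ : ℝ} (hδ : 0 < δ) :
    ∃ n k : ℕ, x ∈ Metric.ball (TopologicalSpace.denseSeq E n) (1 / ((k : ℝ) + 1))
      ∧ 1 / ((k : ℝ) + 1) < δ := by
  obtain ⟨k, hk⟩ := exists_nat_one_div_lt hδ
  obtain ⟨n, hn⟩ := (TopologicalSpace.denseRange_denseSeq E).exists_dist_lt x
    (Nat.one_div_pos_of_nat (α := ℝ) (n := k))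
  exact ⟨n, k, hn, hk⟩

theorem measurable_iInf_edist {Ω E : Type*} [MeasurableSpace Ω] [PseudoMetricSpace E]
    [MeasurableSpace E] [OpensMeasurableSpace E] [TopologicalSpace.SeparableSpace E] [Nonempty E]
    {S : Ω → Set E} (hS : ∀ c r, MeasurableSet {ω | (S ω ∩ Metric.ball c r).Nonempty}) :
    Measurable fun p : E × Ω => ⨅ X ∈ S p.2, edist X p.1 := by
  refine measurable_of_Iio fun r => ?_
  have : (fun p : E × Ω => ⨅ X ∈ S p.2, edist X p.1) ⁻¹' Iio r = ⋃ n : ℕ, ⋃ k : ℕ,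
      {x | edist (TopologicalSpace.denseSeq E n) x + ENNReal.ofReal (1 / ((k : ℝ) + 1)) < r} ×ˢ
      {ω | (S ω ∩ Metric.ball (TopologicalSpace.denseSeq E n) (1 / ((k : ℝ) + 1))).Nonempty} := by
    ext ⟨x, ω⟩
    simp only [mem_preimage, mem_Iio, iInf_lt_iff, mem_iUnion, mem_prod, mem_ofPred_eq]
    constructor
    · rintro ⟨X, hX, hXr⟩
      obtain ⟨δ, hδ, hδr⟩ := ENNReal.lt_iff_exists_add_pos_lt.1 hXr
      obtain ⟨n, k, hn, hk⟩ := exists_mem_ball_denseSeq X (half_pos (NNReal.coe_pos.2 hδ))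
      refine ⟨n, k, lt_of_le_of_lt ?_ hδr, X, hX, hn⟩
      have h1 : edist (TopologicalSpace.denseSeq E n) X ≤ ENNReal.ofReal (1 / ((k : ℝ) + 1)) := by
        rw [edist_comm, edist_dist]
        exact ENNReal.ofReal_le_ofReal (le_of_lt hn)
      calc edist (TopologicalSpace.denseSeq E n) x + ENNReal.ofReal (1 / ((k : ℝ) + 1))
          ≤ (ENNReal.ofReal (1 / ((k : ℝ) + 1)) + edist X x)
            + ENNReal.ofReal (1 / ((k : ℝ) + 1)) :=
            add_le_add_left ((edist_triangle _ X _).trans (add_le_add_left h1 _)) _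
        _ = edist X x + ENNReal.ofReal (1 / ((k : ℝ) + 1) + 1 / ((k : ℝ) + 1)) := by
            rw [ENNReal.ofReal_add (by positivity) (by positivity)]; ring
        _ ≤ edist X x + δ := by
            rw [← ENNReal.ofReal_coe_nnreal]
            gcongr
            linarith
    · rintro ⟨n, k, hnk, X, hX, hXn⟩
      refine ⟨X, hX, lt_of_le_of_lt ?_ hnk⟩
      rw [add_comm]
      refine (edist_triangle X (TopologicalSpace.denseSeq E n) x).trans (add_le_add_left ?_ _)
      rw [edist_dist]
      exact ENNReal.ofReal_le_ofReal (le_of_lt hXn)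
  rw [this]
  refine MeasurableSet.iUnion fun n => MeasurableSet.iUnion fun k =>
    MeasurableSet.prod (IsOpen.measurableSet ?_) (hS _ _)
  exact isOpen_lt (by fun_prop) continuous_const

theorem measurable_linePoint (t : ℝ) : Measurable fun p => linePoint p t := by
  have : (fun p => linePoint p t) = fun p => WithLp.toLp 2 ![p.1 * Real.cos p.2 - t * Real.sin p.2,
    p.1 * Real.sin p.2 + t * Real.cos p.2] := rfl
  rw [this]
  refine (WithLp.measurable_toLp 2 _).comp (measurable_pi_iff.2 fun i => ?_)
  fin_cases i
  · simp only [Fin.zero_eta, Matrix.cons_val_zero]; fun_prop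
  · simp only [Fin.mk_one, Matrix.cons_val_one, Matrix.cons_val_zero]; fun_prop

theorem dist_linePoint (p : Cylinder) (s t : ℝ) :
    dist (linePoint p s) (linePoint p t) = dist s t := by
  rw [EuclideanSpace.dist_eq, Fin.sum_univ_two, Real.dist_eq s t, ← Real.sqrt_sq_eq_abs]
  congr 1
  simp only [linePoint, Real.dist_eq, sq_abs, Matrix.cons_val_zero, Matrix.cons_val_one]
  linear_combination (s - t) ^ 2 * Real.sin_sq_add_cos_sq (p.2 : ℝ)

theorem norm_linePoint_lt_iff (p : Cylinder) (t : ℝ) {r : ℝ} (hr : 0 ≤ r) :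
    ‖linePoint p t‖ < r ↔ t ∈ Ioo (-√(r ^ 2 - p.1 ^ 2)) (√(r ^ 2 - p.1 ^ 2)) := by
  have h : ‖linePoint p t‖ ^ 2 = p.1 ^ 2 + t ^ 2 := by
    rw [EuclideanSpace.norm_sq_eq, Fin.sum_univ_two]
    simp only [linePoint, Real.norm_eq_abs, sq_abs, Matrix.cons_val_zero, Matrix.cons_val_one]
    linear_combination (p.1 ^ 2 + t ^ 2) * Real.sin_sq_add_cos_sq (p.2 : ℝ)
  rw [← pow_lt_pow_iff_left₀ (norm_nonneg _) hr two_ne_zero, h, mem_Ioo, ← Real.sq_lt]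
  constructor <;> intro <;> linarith

theorem measurableSet_linePoint_inter_ball {Ω : Type*} [MeasurableSpace Ω] {road : Ω → Cylinder}
    (hroad : Measurable road) {T : Ω → Set ℝ}
    (hT : ∀ c r, MeasurableSet {ω | (T ω ∩ Metric.ball c r).Nonempty}) (c : Plane) (r : ℝ) :
    MeasurableSet {ω | (linePoint (road ω) '' T ω ∩ Metric.ball c r).Nonempty} := by
  have : {ω | (linePoint (road ω) '' T ω ∩ Metric.ball c r).Nonempty} = ⋃ n : ℕ, ⋃ k : ℕ,
      {ω | dist (linePoint (road ω) (TopologicalSpace.denseSeq ℝ n)) c + 1 / ((k : ℝ) + 1) < r} ∩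
      {ω | (T ω ∩ Metric.ball (TopologicalSpace.denseSeq ℝ n) (1 / ((k : ℝ) + 1))).Nonempty} := by
    ext ω
    simp only [mem_iUnion, mem_inter_iff, mem_ofPred_eq]
    constructor
    · rintro ⟨_, ⟨t, ht, rfl⟩, hr⟩
      obtain ⟨n, k, hn, hk⟩ := exists_mem_ball_denseSeq t (half_pos (sub_pos.2 (Metric.mem_ball.1 hr)))
      refine ⟨n, k, ?_, t, ht, hn⟩
      have h1 := dist_triangle (linePoint (road ω) (TopologicalSpace.denseSeq ℝ n))
        (linePoint (road ω) t) c
      rw [dist_linePoint, dist_comm _ t] at h1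
      rw [Metric.mem_ball] at hn
      linarith
    · rintro ⟨n, k, hnk, t, ht, hn⟩
      refine ⟨_, ⟨t, ht, rfl⟩, ?_⟩
      have h1 := dist_triangle (linePoint (road ω) t)
        (linePoint (road ω) (TopologicalSpace.denseSeq ℝ n)) c
      rw [dist_linePoint] at h1
      rw [Metric.mem_ball] at hn ⊢
      linarith
  rw [this]
  refine MeasurableSet.iUnion fun n => MeasurableSet.iUnion fun k => MeasurableSet.inter ?_ (hT _ _)
  exact measurableSet_lt ((((measurable_linePoint _).comp hroad).dist measurable_const).add_const _)
    measurable_const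

/-! ### The Palm probability of the users -/

theorem volume_unitSquare_ne_zero : (volume : Measure Plane) unitSquare ≠ 0 := by
  have hopen : IsOpen {x : Plane | ∀ i, x i ∈ Ioo (0 : ℝ) 1} := by
    simp only [Set.ofPred_forall]
    exact isOpen_iInter_of_finite fun i => isOpen_Ioo.preimage (by fun_prop)
  have hne : {x : Plane | ∀ i, x i ∈ Ioo (0 : ℝ) 1}.Nonempty :=
    ⟨WithLp.toLp 2 fun _ => 1 / 2, fun i => by constructor <;> norm_num⟩
  exact ((hopen.measure_pos volume hne).trans_le
    (measure_mono fun x hx i => Ioo_subset_Ico_self (hx i))).ne'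

theorem volume_unitSquare_lt_top : (volume : Measure Plane) unitSquare < ∞ :=
  isBounded_unitSquare.measure_lt_top

namespace PointProcess

theorem measurableSet_inter_ball_nonempty {Ω E : Type*} [MeasurableSpace Ω] [PseudoMetricSpace E]
    [MeasurableSpace E] [OpensMeasurableSpace E] [MeasurableSingletonClass E]
    (Φ : PointProcess Ω E) (c : E) (r : ℝ) :
    MeasurableSet[Φ.sigmaAlgebra] {ω | (Φ.points ω ∩ Metric.ball c r).Nonempty} := by
  have h := Φ.measurable_number_sigmaAlgebra (Metric.isOpen_ball (x := c) (ε := r)).measurableSet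
  have : {ω | (Φ.points ω ∩ Metric.ball c r).Nonempty}
      = (Φ.number (Metric.ball c r) ⁻¹' {0})ᶜ := by
    ext ω
    simp [number, Set.nonempty_iff_ne_empty]
  rw [this]
  exact (h (measurableSet_singleton 0)).compl

end PointProcess

theorem iInf_edist_zero_flow {Ω : Type*} {θ : Plane → Ω → Ω} {S : Ω → Set Plane}
    (h : FlowCompatible θ S) (x : Plane) (ω : Ω) :
    ⨅ X ∈ S (θ x ω), ‖X‖ₑ = ⨅ X ∈ S ω, edist X x := by
  rw [h x ω, iInf_image]
  simp only [edist_eq_enorm_sub]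

namespace VehicularNetwork

variable {Ω : Type*} [MeasurableSpace Ω] {P : Measure Ω} {θ : Plane → Ω → Ω}
  {lamB lamU lamL muB : ℝ}

/-- The σ-algebra generated by the roads. -/
@[reducible]
def roadAlgebra (N : VehicularNetwork P θ lamB lamU lamL muB) : MeasurableSpace Ω :=
  MeasurableSpace.comap (fun ω i => N.road i ω) inferInstance

/-- The σ-algebra generated by the processes on the roads. -/
@[reducible]
def vehicleAlgebra (N : VehicularNetwork P θ lamB lamU lamL muB) : MeasurableSpace Ω :=
  ⨆ i, (N.φ i).sigmaAlgebra

variable (N : VehicularNetwork P θ lamB lamU lamL muB)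

theorem roadAlgebra_le : N.roadAlgebra ≤ ‹MeasurableSpace Ω› :=
  (measurable_pi_iff.2 N.measurable_road).comap_le

theorem vehicleAlgebra_le : N.vehicleAlgebra ≤ ‹MeasurableSpace Ω› :=
  iSup_le fun i => (N.φ i).sigmaAlgebra_le

/-- The σ-algebra generated by the base stations. -/
@[reducible]
def environmentAlgebra : MeasurableSpace Ω :=
  N.Φb.sigmaAlgebra ⊔ (N.roadAlgebra ⊔ N.vehicleAlgebra)

theorem environmentAlgebra_le : N.environmentAlgebra ≤ ‹MeasurableSpace Ω› :=
  sup_le N.Φb.sigmaAlgebra_le (sup_le N.roadAlgebra_le N.vehicleAlgebra_le)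

theorem algebra_le (i : Fin 4) : ![N.Φb.sigmaAlgebra, N.Φu.sigmaAlgebra, N.roadAlgebra,
    N.vehicleAlgebra] i ≤ ‹MeasurableSpace Ω› := by
  fin_cases i
  · exact N.Φb.sigmaAlgebra_le
  · exact N.Φu.sigmaAlgebra_le
  · exact N.roadAlgebra_le
  · exact N.vehicleAlgebra_le

theorem indep_users_environment :
    Indep N.Φu.sigmaAlgebra N.environmentAlgebra P := by
  have h := indep_iSup_of_disjoint (S := {1}) (T := {0, 2, 3}) N.algebra_le N.indep
    (by simp)
  simpa [iSup_or, iSup_sup_eq] using h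

theorem indep_planar_vehicular :
    Indep N.Φb.sigmaAlgebra (N.roadAlgebra ⊔ N.vehicleAlgebra) P := by
  have h := indep_iSup_of_disjoint (S := {0}) (T := {2, 3}) N.algebra_le N.indep (by simp)
  simpa [iSup_or, iSup_sup_eq] using h

theorem indep_road_vehicle : Indep N.roadAlgebra N.vehicleAlgebra P := by
  have h := N.indep.indep (i := 2) (j := 3) (by decide)
  simpa using h

theorem measurable_planar_distance :
    Measurable[Prod.instMeasurableSpace (m₂ := N.Φb.sigmaAlgebra)] fun p : Plane × Ω =>
      ⨅ X ∈ N.Φb.points p.2, edist X p.1 :=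
  @measurable_iInf_edist Ω Plane N.Φb.sigmaAlgebra _ _ _ _ _ _
    fun c r => N.Φb.measurableSet_inter_ball_nonempty c r

theorem measurable_vehicular_distance :
    Measurable[Prod.instMeasurableSpace (m₂ := N.roadAlgebra ⊔ N.vehicleAlgebra)]
      fun p : Plane × Ω => ⨅ X ∈ N.Ψb p.2, edist X p.1 := by
  refine @measurable_iInf_edist Ω Plane (N.roadAlgebra ⊔ N.vehicleAlgebra) _ _ _ _ _ _
    fun c r => ?_
  have : {ω | (N.Ψb ω ∩ Metric.ball c r).Nonempty} =
      ⋃ i, {ω | (linePoint (N.road i ω) '' (N.φ i).points ω ∩ Metric.ball c r).Nonempty} := by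
    ext ω
    simp only [Ψb, iUnion_inter, nonempty_iUnion, mem_ofPred_eq, mem_iUnion]
  rw [this]
  refine MeasurableSet.iUnion fun i => ?_
  have hroad : Measurable[N.roadAlgebra ⊔ N.vehicleAlgebra] (N.road i) := by
    have h : Measurable[N.roadAlgebra] (N.road i) :=
      (measurable_pi_apply i).comp (comap_measurable fun ω i => N.road i ω)
    exact h.mono le_sup_left le_rfl
  refine @measurableSet_linePoint_inter_ball Ω (N.roadAlgebra ⊔ N.vehicleAlgebra) _ hroad _
    (fun c r => ?_) c r
  exact (le_iSup (fun i => (N.φ i).sigmaAlgebra) i).trans le_sup_right _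
    ((N.φ i).measurableSet_inter_ball_nonempty c r)

theorem measurable_Rp : Measurable[N.Φb.sigmaAlgebra] N.Rp := by
  have h := N.measurable_planar_distance.comp
    (@measurable_prodMk_left Plane Ω _ N.Φb.sigmaAlgebra 0)
  simp only [Function.comp_def, edist_zero_right] at h
  exact h

theorem measurable_Rv : Measurable[N.roadAlgebra ⊔ N.vehicleAlgebra] N.Rv := by
  have h := N.measurable_vehicular_distance.comp
    (@measurable_prodMk_left Plane Ω _ (N.roadAlgebra ⊔ N.vehicleAlgebra) 0)
  simp only [Function.comp_def, edist_zero_right] at h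
  exact h

theorem measurable_Rp' : Measurable N.Rp := N.measurable_Rp.mono N.Φb.sigmaAlgebra_le le_rfl

theorem measurable_Rv' : Measurable N.Rv :=
  N.measurable_Rv.mono (sup_le N.roadAlgebra_le N.vehicleAlgebra_le) le_rfl

theorem indepFun_Rp_Rv : IndepFun N.Rp N.Rv P :=
  (IndepFun_iff_Indep _ _ _).2 (indep_of_indep_of_le_left (indep_of_indep_of_le_right
    N.indep_planar_vehicular N.measurable_Rv.comap_le) N.measurable_Rp.comap_le)

theorem R_eq_min (ω : Ω) : N.R ω = min (N.Rp ω) (N.Rv ω) := iInf_union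

/-- The distances seen by the typical user have the same joint law as those seen from the
origin. -/
theorem map_palm_eq [IsProbabilityMeasure P] (hU : 0 < lamU) :
    (palm P θ N.Φu).map (fun ω => (N.Rp ω, N.Rv ω)) = P.map fun ω => (N.Rp ω, N.Rv ω) := by
  have hm : Measurable fun ω => (N.Rp ω, N.Rv ω) := N.measurable_Rp'.prodMk N.measurable_Rv'
  have hfin : (ENNReal.ofReal lamU • (volume : Measure Plane)) unitSquare < ∞ := by
    rw [Measure.smul_apply, smul_eq_mul]
    exact ENNReal.mul_lt_top ENNReal.ofReal_lt_top volume_unitSquare_lt_top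
  have hne : (ENNReal.ofReal lamU • (volume : Measure Plane)) unitSquare ≠ 0 := by
    rw [Measure.smul_apply, smul_eq_mul]
    exact mul_ne_zero (by simpa using hU) volume_unitSquare_ne_zero
  have hint : spatialIntensity P N.Φu = (ENNReal.ofReal lamU • (volume : Measure Plane)) unitSquare :=
    N.poisson_Φu.lintegral_number measurableSet_unitSquare hfin
  ext B hB
  rw [Measure.map_apply hm hB, Measure.map_apply hm hB, palm_apply N.framework N.Φu (hm hB)]
  let H : Set (Plane × Ω) := {p | ((⨅ X ∈ N.Φb.points p.2, edist X p.1),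
    (⨅ X ∈ N.Ψb p.2, edist X p.1)) ∈ B}
  have hflow : ∀ x ω, (x, ω) ∈ H ↔ θ x ω ∈ (fun ω => (N.Rp ω, N.Rv ω)) ⁻¹' B := by
    intro x ω
    change _ ↔ ((⨅ X ∈ N.Φb.points (θ x ω), ‖X‖ₑ), (⨅ X ∈ N.Ψb (θ x ω), ‖X‖ₑ)) ∈ B
    rw [iInf_edist_zero_flow N.compatible_Φb, iInf_edist_zero_flow (S := N.Ψb) N.compatible_Ψb]
    rfl
  have hH : MeasurableSet[Prod.instMeasurableSpace (m₂ := N.environmentAlgebra)] H := by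
    have h1 := N.measurable_planar_distance.mono
      (sup_le_sup_left (MeasurableSpace.comap_mono (le_sup_left : _ ≤ N.environmentAlgebra)) _) le_rfl
    have h2 := N.measurable_vehicular_distance.mono
      (sup_le_sup_left (MeasurableSpace.comap_mono (le_sup_right : _ ≤ N.environmentAlgebra)) _) le_rfl
    exact Measurable.prodMk (m := Prod.instMeasurableSpace (m₂ := N.environmentAlgebra)) h1 h2 hB
  have hind : @IndepFun Ω _ Ω _ _ N.environmentAlgebra N.Φu.countingMeasure id P := by
    refine (@IndepFun_iff_Indep Ω _ _ _ _ N.environmentAlgebra _ _ P).2 ?_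
    rw [@MeasurableSpace.comap_id Ω N.environmentAlgebra]
    exact N.indep_users_environment
  have hcamp := N.poisson_Φu.lintegral_number_of_indepFun (mZ := N.environmentAlgebra) (Z := id)
    (measurable_id.mono N.environmentAlgebra_le le_rfl) hind measurableSet_unitSquare
    isBounded_unitSquare hfin hH
  have hleft : ∀ ω, ({X ∈ N.Φu.points ω | X ∈ unitSquare ∧
      θ X ω ∈ (fun ω => (N.Rp ω, N.Rv ω)) ⁻¹' B}).encard
      = (N.Φu.points ω ∩ ({x | (x, id ω) ∈ H} ∩ unitSquare)).encard := by
    intro ω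
    congr 1
    ext X
    simp only [mem_inter_iff, mem_ofPred_eq, id, hflow]
    tauto
  have hright : ∀ x, P {ω | (x, id ω) ∈ H} = P ((fun ω => (N.Rp ω, N.Rv ω)) ⁻¹' B) := by
    intro x
    rw [← (N.framework.measurePreserving x).measure_preimage (hm hB).nullMeasurableSet]
    congr 1
    ext ω
    exact hflow x ω
  simp only [hleft]
  change _ * ∫⁻ ω, N.Φu.number _ ω ∂P = _
  rw [hcamp]
  simp only [hright]
  rw [lintegral_const, Measure.restrict_apply_univ, hint, mul_comm (P _), ← mul_assoc,
    ENNReal.inv_mul_cancel hne hfin.ne, one_mul]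

theorem isProbabilityMeasure_palm [IsProbabilityMeasure P] (hU : 0 < lamU) :
    IsProbabilityMeasure (palm P θ N.Φu) := by
  have hm : Measurable fun ω => (N.Rp ω, N.Rv ω) := N.measurable_Rp'.prodMk N.measurable_Rv'
  have h := N.map_palm_eq hU
  constructor
  rw [← preimage_univ (f := fun ω => (N.Rp ω, N.Rv ω)), ← Measure.map_apply hm .univ, h,
    Measure.map_apply hm .univ, preimage_univ, measure_univ]

theorem indepFun_palm [IsProbabilityMeasure P] (hU : 0 < lamU) :
    IndepFun N.Rp N.Rv (palm P θ N.Φu) := by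
  have := N.isProbabilityMeasure_palm hU
  have hp := N.measurable_Rp'
  have hv := N.measurable_Rv'
  have h := N.map_palm_eq hU
  have h1 : (palm P θ N.Φu).map N.Rp = P.map N.Rp := by
    have := congrArg (Measure.map Prod.fst) h
    rwa [Measure.map_map measurable_fst (hp.prodMk hv),
      Measure.map_map measurable_fst (hp.prodMk hv)] at this
  have h2 : (palm P θ N.Φu).map N.Rv = P.map N.Rv := by
    have := congrArg (Measure.map Prod.snd) h
    rwa [Measure.map_map measurable_snd (hp.prodMk hv),
      Measure.map_map measurable_snd (hp.prodMk hv)] at this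
  rw [indepFun_iff_map_prod_eq_prod_map_map hp.aemeasurable hv.aemeasurable, h, h1, h2]
  exact (indepFun_iff_map_prod_eq_prod_map_map hp.aemeasurable hv.aemeasurable).1 N.indepFun_Rp_Rv

end VehicularNetwork

/-! ### Void probabilities -/

theorem measure_mem_eq_lintegral_of_indepFun {Ω X' Z' : Type*} [MeasurableSpace Ω]
    [MeasurableSpace X'] [MeasurableSpace Z'] {P : Measure Ω} [IsProbabilityMeasure P]
    {X : Ω → X'} {Z : Ω → Z'} (hX : Measurable X) (hZ : Measurable Z) (h : IndepFun X Z P)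
    {H : Set (X' × Z')} (hH : MeasurableSet H) :
    P {ω | (X ω, Z ω) ∈ H} = ∫⁻ ω, P {ω' | (X ω, Z ω') ∈ H} ∂P := by
  have h1 : P {ω | (X ω, Z ω) ∈ H} = P.map (fun ω => (X ω, Z ω)) H :=
    (Measure.map_apply (hX.prodMk hZ) hH).symm
  have : IsProbabilityMeasure (P.map Z) := Measure.isProbabilityMeasure_map hZ.aemeasurable
  rw [h1, (indepFun_iff_map_prod_eq_prod_map_map hX.aemeasurable hZ.aemeasurable).1 h,
    Measure.prod_apply hH, lintegral_map (measurable_measure_prodMk_left hH) hX]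
  refine lintegral_congr fun ω => ?_
  rw [Measure.map_apply hZ (measurable_prodMk_left hH)]
  rfl

theorem le_iInf_enorm_iff {S : Set Plane} {r : ℝ} :
    ENNReal.ofReal r ≤ ⨅ X ∈ S, ‖X‖ₑ ↔ ¬ (S ∩ Metric.ball 0 r).Nonempty := by
  simp only [le_iInf_iff, Set.not_nonempty_iff_eq_empty, Set.eq_empty_iff_forall_notMem,
    mem_inter_iff, Metric.mem_ball, dist_zero_right, not_and, not_lt]
  refine forall₂_congr fun X _ => ?_
  rw [← ofReal_norm, ENNReal.ofReal_le_ofReal_iff (norm_nonneg X)]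

theorem linePoint_inter_ball_nonempty_iff (p : Cylinder) (T : Set ℝ) {r : ℝ} (hr : 0 ≤ r) :
    (linePoint p '' T ∩ Metric.ball 0 r).Nonempty ↔
      (T ∩ Ioo (-√(r ^ 2 - p.1 ^ 2)) (√(r ^ 2 - p.1 ^ 2))).Nonempty := by
  simp only [← norm_linePoint_lt_iff p _ hr, Set.Nonempty, mem_inter_iff, mem_image,
    Metric.mem_ball, dist_zero_right]
  constructor
  · rintro ⟨_, ⟨t, ht, rfl⟩, h⟩
    exact ⟨t, ht, h⟩
  · rintro ⟨t, ht, h⟩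
    exact ⟨_, ⟨t, ht, rfl⟩, h⟩

namespace PointProcess

theorem lintegral_countingMeasure_of_range {Ω E : Type*} [MeasurableSpace Ω] [PseudoMetricSpace E]
    [MeasurableSpace E] [MeasurableSingletonClass E] (Φ : PointProcess Ω E) {ω : Ω} {x : ℕ → E}
    (hx : Function.Injective x) (hr : range x = Φ.points ω) {f : E → ℝ≥0∞} (hf : Measurable f) :
    ∫⁻ y, f y ∂Φ.countingMeasure ω = ∑' i, f (x i) := by
  have hS : MeasurableSet (range x) := (countable_range x).measurableSet
  rw [countingMeasure, ← hr, ← lintegral_indicator hS, lintegral_count' (hf.indicator hS),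
    ← tsum_subtype, tsum_range f hx]

end PointProcess

/-- The integral `∫₀ʳ (1 - exp (-2 μ √(r² - t²))) dt`. -/
def roadExponent (muB r : ℝ) : ℝ :=
  ∫ t in (0 : ℝ)..r, (1 - Real.exp (-2 * muB * √(r ^ 2 - t ^ 2)))

theorem roadExponent_nonneg {muB r : ℝ} (hmu : 0 ≤ muB) (hr : 0 ≤ r) : 0 ≤ roadExponent muB r := by
  refine intervalIntegral.integral_nonneg hr fun t _ => ?_
  have : Real.exp (-2 * muB * √(r ^ 2 - t ^ 2)) ≤ 1 := by
    rw [Real.exp_le_one_iff]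
    have := mul_nonneg hmu (Real.sqrt_nonneg (r ^ 2 - t ^ 2))
    linarith
  linarith

theorem lintegral_one_sub_exp_sqrt {muB r : ℝ} (hmu : 0 ≤ muB) (hr : 0 ≤ r) :
    ∫⁻ t : ℝ, ENNReal.ofReal (1 - Real.exp (-2 * muB * √(r ^ 2 - t ^ 2)))
      = ENNReal.ofReal (2 * roadExponent muB r) := by
  set h : ℝ → ℝ := fun t => 1 - Real.exp (-2 * muB * √(r ^ 2 - t ^ 2)) with hh
  have hc : Continuous h := by fun_prop
  have hnn : ∀ t, 0 ≤ h t := fun t => by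
    have : Real.exp (-2 * muB * √(r ^ 2 - t ^ 2)) ≤ 1 := by
      rw [Real.exp_le_one_iff]
      have := mul_nonneg hmu (Real.sqrt_nonneg (r ^ 2 - t ^ 2))
      linarith
    simp only [hh]; linarith
  have hzero : ∀ t, t ∉ Ioc (-r) r → h t = 0 := fun t ht => by
    have : r ^ 2 - t ^ 2 ≤ 0 := by
      rw [mem_Ioc, not_and_or, not_lt, not_le] at ht
      rcases ht with ht | ht <;> nlinarith
    simp [hh, Real.sqrt_eq_zero_of_nonpos this]
  have h1 : ∫⁻ t : ℝ, ENNReal.ofReal (h t) = ∫⁻ t in Ioc (-r) r, ENNReal.ofReal (h t) := by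
    rw [← lintegral_indicator measurableSet_Ioc]
    refine lintegral_congr fun t => ?_
    by_cases ht : t ∈ Ioc (-r) r
    · simp [ht]
    · simp [ht, hzero t ht]
  have hint : ∀ a b, IntervalIntegrable h volume a b := fun a b => hc.intervalIntegrable a b
  rw [h1, ← ofReal_integral_eq_lintegral_ofReal ((hint (-r) r).1)
    (Filter.Eventually.of_forall hnn), ← intervalIntegral.integral_of_le (by linarith),
    ← intervalIntegral.integral_add_adjacent_intervals (hint (-r) 0) (hint 0 r)]
  congr 1
  have h2 : ∫ t in (-r)..0, h t = ∫ t in (0 : ℝ)..r, h t := by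
    have := intervalIntegral.integral_comp_neg (a := 0) (b := r) h
    rw [neg_zero] at this
    rw [← this]
    simp [hh]
  rw [h2, roadExponent]
  ring

namespace VehicularNetwork

variable {Ω : Type*} [MeasurableSpace Ω] {P : Measure Ω} {θ : Plane → Ω → Ω}
  {lamB lamU lamL muB : ℝ} (N : VehicularNetwork P θ lamB lamU lamL muB)

theorem measure_le_Rp (hB : 0 < lamB) {r : ℝ} (hr : 0 ≤ r) :
    P {ω | ENNReal.ofReal r ≤ N.Rp ω} = ENNReal.ofReal (Real.exp (-Real.pi * lamB * r ^ 2)) := by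
  have hvol : (ENNReal.ofReal lamB • (volume : Measure Plane)) (Metric.ball 0 r)
      = ENNReal.ofReal (Real.pi * lamB * r ^ 2) := by
    rw [Measure.smul_apply, smul_eq_mul, EuclideanSpace.volume_ball_fin_two,
      ← ENNReal.ofReal_pow hr, ← ENNReal.ofReal_mul (by positivity), ← ENNReal.ofReal_mul hB.le]
    congr 1; ring
  have h := N.poisson_Φb.measure_number_eq_zero (Metric.isOpen_ball (x := (0 : Plane))
    (ε := r)).measurableSet (by rw [hvol]; exact ENNReal.ofReal_lt_top)
  rw [hvol, expNeg, ENNReal.toReal_ofReal (by positivity)] at h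
  rw [show -Real.pi * lamB * r ^ 2 = -(Real.pi * lamB * r ^ 2) by ring, ← h]
  congr 1
  ext ω
  simp only [mem_ofPred_eq]
  rw [Rp, le_iInf_enorm_iff, Set.not_nonempty_iff_eq_empty, PointProcess.number]
  simp

/-- Given the first `n` roads, the probability that none of them has a vehicular base station
at distance less than `r`. -/
theorem measure_vehicles_void (hmu : 0 ≤ muB) {r : ℝ} (hr : 0 ≤ r) (p : ℕ → Cylinder) (n : ℕ) :
    P (⋂ i ∈ Finset.range n,
        {ω | ¬ (linePoint (p i) '' (N.φ i).points ω ∩ Metric.ball 0 r).Nonempty})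
      = ∏ i ∈ Finset.range n, expNeg (ENNReal.ofReal (2 * muB * √(r ^ 2 - (p i).1 ^ 2))) := by
  have heq : ∀ i, {ω | ¬ (linePoint (p i) '' (N.φ i).points ω ∩ Metric.ball 0 r).Nonempty}
      = (N.φ i).number (Ioo (-√(r ^ 2 - (p i).1 ^ 2)) (√(r ^ 2 - (p i).1 ^ 2))) ⁻¹' {0} := by
    intro i
    ext ω
    rw [mem_ofPred_eq, linePoint_inter_ball_nonempty_iff _ _ hr, Set.not_nonempty_iff_eq_empty]
    simp [PointProcess.number]
  simp only [heq]
  rw [N.indep_φ.meas_biInter fun i _ =>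
    (N.φ i).measurable_number_sigmaAlgebra measurableSet_Ioo (measurableSet_singleton 0)]
  refine Finset.prod_congr rfl fun i _ => ?_
  have hvol : (ENNReal.ofReal muB • (volume : Measure ℝ))
      (Ioo (-√(r ^ 2 - (p i).1 ^ 2)) (√(r ^ 2 - (p i).1 ^ 2)))
      = ENNReal.ofReal (2 * muB * √(r ^ 2 - (p i).1 ^ 2)) := by
    rw [Measure.smul_apply, smul_eq_mul, Real.volume_Ioo, ← ENNReal.ofReal_mul hmu]
    congr 1; ring
  rw [← hvol]
  exact (N.poisson_φ i).measure_number_eq_zero measurableSet_Ioo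
    (by rw [hvol]; exact ENNReal.ofReal_lt_top)

theorem measure_roads_void [IsProbabilityMeasure P] (hmu : 0 ≤ muB) {r : ℝ} (hr : 0 ≤ r) (n : ℕ) :
    P (⋂ i ∈ Finset.range n,
        {ω | ¬ (linePoint (N.road i ω) '' (N.φ i).points ω ∩ Metric.ball 0 r).Nonempty})
      = ∫⁻ ω, expNeg (∑ i ∈ Finset.range n,
          ENNReal.ofReal (2 * muB * √(r ^ 2 - (N.road i ω).1 ^ 2))) ∂P := by
  let H : Set ((ℕ → Cylinder) × Ω) := ⋂ i ∈ Finset.range n,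
    {q | ¬ (linePoint (q.1 i) '' (N.φ i).points q.2 ∩ Metric.ball 0 r).Nonempty}
  have hH : MeasurableSet[Prod.instMeasurableSpace (m₂ := N.vehicleAlgebra)] H := by
    refine MeasurableSet.biInter (Finset.countable_toSet _) fun i _ => MeasurableSet.compl ?_
    refine @measurableSet_linePoint_inter_ball _ (Prod.instMeasurableSpace (m₂ := N.vehicleAlgebra))
      (fun q : (ℕ → Cylinder) × Ω => q.1 i) ?_ (fun q => (N.φ i).points q.2) (fun c s => ?_) 0 r
    · exact (measurable_pi_apply i).comp (@measurable_fst _ _ _ N.vehicleAlgebra)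
    · exact (@measurable_snd _ _ _ N.vehicleAlgebra)
        (le_iSup (fun i => (N.φ i).sigmaAlgebra) i _
          ((N.φ i).measurableSet_inter_ball_nonempty c s))
  have hind : @IndepFun Ω _ Ω _ _ N.vehicleAlgebra (fun ω i => N.road i ω) id P := by
    refine (@IndepFun_iff_Indep Ω _ _ _ _ N.vehicleAlgebra _ _ P).2 ?_
    rw [@MeasurableSpace.comap_id Ω N.vehicleAlgebra]
    exact N.indep_road_vehicle
  have h := @measure_mem_eq_lintegral_of_indepFun Ω _ Ω _ _ N.vehicleAlgebra P _ _ id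
    (measurable_pi_iff.2 N.measurable_road) (measurable_id.mono N.vehicleAlgebra_le le_rfl) hind H hH
  have hl : {ω | ((fun i => N.road i ω), id ω) ∈ H} = ⋂ i ∈ Finset.range n,
      {ω | ¬ (linePoint (N.road i ω) '' (N.φ i).points ω ∩ Metric.ball 0 r).Nonempty} := by
    ext ω; simp [H]
  have hrr : ∀ ω, {ω' | ((fun i => N.road i ω), id ω') ∈ H} = ⋂ i ∈ Finset.range n,
      {ω' | ¬ (linePoint (N.road i ω) '' (N.φ i).points ω' ∩ Metric.ball 0 r).Nonempty} := by
    intro ω; ext ω'; simp [H]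
  rw [hl] at h
  rw [h]
  refine lintegral_congr fun ω => ?_
  rw [hrr, N.measure_vehicles_void hmu hr, expNeg_sum _ _ fun i _ => ENNReal.ofReal_ne_top]

theorem measure_le_Rv_eq_laplace [IsProbabilityMeasure P] (hmu : 0 ≤ muB) {r : ℝ} (hr : 0 ≤ r)
    (hfin : ∀ ω, ∫⁻ q, ENNReal.ofReal (2 * muB * √(r ^ 2 - q.1 ^ 2)) ∂N.Ξ.countingMeasure ω ≠ ∞) :
    P {ω | ENNReal.ofReal r ≤ N.Rv ω} = ∫⁻ ω, expNeg
      (∫⁻ q, ENNReal.ofReal (2 * muB * √(r ^ 2 - q.1 ^ 2)) ∂N.Ξ.countingMeasure ω) ∂P := by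
  let A : ℕ → Set Ω := fun i =>
    {ω | ¬ (linePoint (N.road i ω) '' (N.φ i).points ω ∩ Metric.ball 0 r).Nonempty}
  have hA : ∀ i, MeasurableSet (A i) := fun i =>
    (measurableSet_linePoint_inter_ball (N.measurable_road i)
      (fun c s => (N.φ i).sigmaAlgebra_le _
        ((N.φ i).measurableSet_inter_ball_nonempty c s)) 0 r).compl
  have hset : {ω | ENNReal.ofReal r ≤ N.Rv ω} = ⋂ n, ⋂ i ∈ Finset.range n, A i := by
    ext ω
    simp only [mem_ofPred_eq]
    rw [Rv, le_iInf_enorm_iff, Ψb, iUnion_inter, nonempty_iUnion, not_exists]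
    simp only [mem_iInter, Finset.mem_range]
    exact ⟨fun h n i _ => h i, fun h i => h (i + 1) i (Nat.lt_succ_self i)⟩
  have hm : ∀ i, Measurable fun ω => ENNReal.ofReal (2 * muB * √(r ^ 2 - (N.road i ω).1 ^ 2)) := by
    intro i
    have := N.measurable_road i
    fun_prop
  have hsum : ∀ ω, ∫⁻ q, ENNReal.ofReal (2 * muB * √(r ^ 2 - q.1 ^ 2)) ∂N.Ξ.countingMeasure ω
      = ∑' i, ENNReal.ofReal (2 * muB * √(r ^ 2 - (N.road i ω).1 ^ 2)) := fun ω =>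
    N.Ξ.lintegral_countingMeasure_of_range (N.injective_road ω) (N.range_road ω) (by fun_prop)
  have h1 : Filter.Tendsto (fun n => P (⋂ i ∈ Finset.range n, A i)) Filter.atTop
      (nhds (P {ω | ENNReal.ofReal r ≤ N.Rv ω})) := by
    rw [hset]
    refine tendsto_measure_iInter_atTop
      (fun n => (Finset.measurableSet_biInter _ fun i _ => hA i).nullMeasurableSet)
      (fun m n hmn => ?_) ⟨0, measure_ne_top _ _⟩
    exact biInter_subset_biInter_left (Finset.range_mono hmn)
  have h2 : Filter.Tendsto (fun n => P (⋂ i ∈ Finset.range n, A i)) Filter.atTop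
      (nhds (∫⁻ ω, expNeg
      (∫⁻ q, ENNReal.ofReal (2 * muB * √(r ^ 2 - q.1 ^ 2)) ∂N.Ξ.countingMeasure ω) ∂P)) := by
    simp only [A, N.measure_roads_void hmu hr]
    refine tendsto_lintegral_of_dominated_convergence (fun _ => 1) (fun n => ?_)
      (fun n => Filter.Eventually.of_forall fun ω => expNeg_le_one _) (by simp)
      (Filter.Eventually.of_forall fun ω => ?_)
    · exact measurable_expNeg.comp (Finset.measurable_sum _ fun i _ => hm i)
    · refine tendsto_expNeg (hfin ω) ?_
      rw [hsum]
      exact ENNReal.tendsto_nat_tsum _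
  exact tendsto_nhds_unique h1 h2

theorem measure_le_Rv [IsProbabilityMeasure P] (hL : 0 < lamL) (hmu : 0 < muB) {r : ℝ}
    (hr : 0 ≤ r) :
    P {ω | ENNReal.ofReal r ≤ N.Rv ω}
      = ENNReal.ofReal (Real.exp (-2 * lamL * roadExponent muB r)) := by
  let f : Cylinder → ℝ≥0∞ := fun q => ENNReal.ofReal (2 * muB * √(r ^ 2 - q.1 ^ 2))
  have hf : Measurable f := by fun_prop
  let B : Set Cylinder := Ioo (-r) r ×ˢ univ
  have hBm : MeasurableSet B := measurableSet_Ioo.prod .univ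
  have hBb : Bornology.IsBounded B := by
    refine (Metric.isBounded_Ioo _ _).prod ?_
    rw [← Bornology.isBounded_image_subtype_val]
    exact (Metric.isBounded_Ico _ _).subset (Subtype.coe_image_subset _ _)
  have hcyl : (Measure.comap Subtype.val (volume : Measure ℝ))
      (univ : Set (Ico (0 : ℝ) Real.pi)) = ENNReal.ofReal Real.pi := by
    rw [comap_subtype_coe_apply measurableSet_Ico, image_univ, Subtype.range_coe, Real.volume_Ico,
      sub_zero]
  have : IsFiniteMeasure (Measure.comap (Subtype.val : Ico (0 : ℝ) Real.pi → ℝ) volume) :=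
    ⟨by rw [hcyl]; exact ENNReal.ofReal_lt_top⟩
  have hfB : ∀ q, q ∉ B → f q = 0 := fun q hq => by
    have : r ^ 2 - q.1 ^ 2 ≤ 0 := by
      simp only [B, mem_prod, mem_Ioo, mem_univ, and_true, not_and_or, not_lt] at hq
      rcases hq with hq | hq <;> nlinarith
    simp [f, Real.sqrt_eq_zero_of_nonpos this]
  have hfle : ∀ q, f q ≤ B.indicator (fun _ => ENNReal.ofReal (2 * muB * r)) q := fun q => by
    by_cases hq : q ∈ B
    · rw [indicator_of_mem hq]
      refine ENNReal.ofReal_le_ofReal (mul_le_mul_of_nonneg_left ?_ (by positivity))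
      exact Real.sqrt_le_iff.2 ⟨hr, by nlinarith [sq_nonneg q.1]⟩
    · rw [hfB q hq]; exact zero_le
  have hfin : ∀ ω, ∫⁻ q, f q ∂N.Ξ.countingMeasure ω ≠ ∞ := fun ω => by
    refine ne_top_of_le_ne_top ?_ (lintegral_mono hfle)
    rw [lintegral_indicator_const hBm, N.Ξ.countingMeasure_apply ω hBm]
    exact ENNReal.mul_ne_top ENNReal.ofReal_ne_top (N.Ξ.number_ne_top hBb ω)
  have hΛ : (ENNReal.ofReal (lamL / Real.pi) • cylinderMeasure) B < ∞ := by
    rw [Measure.smul_apply, smul_eq_mul, cylinderMeasure, Measure.prod_prod, hcyl, Real.volume_Ioo]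
    exact ENNReal.mul_lt_top ENNReal.ofReal_lt_top
      (ENNReal.mul_lt_top ENNReal.ofReal_lt_top ENNReal.ofReal_lt_top)
  rw [N.measure_le_Rv_eq_laplace hmu.le hr hfin,
    N.poisson_Ξ.lintegral_expNeg_lintegral hBb hBm hΛ hf (fun q => ENNReal.ofReal_ne_top) hfB hfin]
  have h1 : ∀ q : Cylinder, 1 - expNeg (f q)
      = ENNReal.ofReal (1 - Real.exp (-2 * muB * √(r ^ 2 - q.1 ^ 2))) := fun q => by
    rw [expNeg, ENNReal.toReal_ofReal (by positivity), ENNReal.ofReal_sub _ (Real.exp_pos _).le,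
      ENNReal.ofReal_one]
    congr 4; ring
  simp only [h1]
  rw [lintegral_smul_measure, cylinderMeasure,
    lintegral_prod _ (by fun_prop)]
  simp only [lintegral_const, hcyl]
  rw [lintegral_mul_const _ (by fun_prop), lintegral_one_sub_exp_sqrt hmu.le hr, expNeg]
  have hG := roadExponent_nonneg hmu.le hr
  rw [smul_eq_mul, ← ENNReal.ofReal_mul (by positivity), ← ENNReal.ofReal_mul (by positivity),
    ENNReal.toReal_ofReal (by positivity)]
  congr 2
  field_simp

end VehicularNetwork

/-! ### The derivative of the void probability -/

theorem intervalIntegral_comp_mul_sin {r : ℝ} (hr : 0 < r) (h : ℝ → ℝ) :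
    ∫ u in (0 : ℝ)..r, h u
      = ∫ φ in (0 : ℝ)..(Real.pi / 2), r * Real.cos φ * h (r * Real.sin φ) := by
  have hpi : (0 : ℝ) ≤ Real.pi / 2 := by positivity
  have hsub : Ioo 0 (Real.pi / 2) ⊆ Icc (-(Real.pi / 2)) (Real.pi / 2) := fun φ hφ =>
    ⟨by linarith [hφ.1], hφ.2.le⟩
  have himg : (fun φ => r * Real.sin φ) '' Ioo 0 (Real.pi / 2) = Ioo 0 r := by
    ext u
    constructor
    · rintro ⟨φ, hφ, rfl⟩
      have h0 : 0 < Real.sin φ := Real.sin_pos_of_pos_of_lt_pi hφ.1 (by linarith [hφ.2, Real.pi_pos])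
      have h1 : Real.sin φ < 1 := by
        rw [← Real.sin_pi_div_two]
        exact Real.strictMonoOn_sin (hsub hφ) ⟨by linarith, le_rfl⟩ hφ.2
      exact ⟨mul_pos hr h0, by nlinarith⟩
    · rintro ⟨h0, h1⟩
      have hd : u / r < 1 := (div_lt_one hr).2 h1
      refine ⟨Real.arcsin (u / r), ⟨Real.arcsin_pos.2 (by positivity),
        Real.arcsin_lt_pi_div_two.2 hd⟩, ?_⟩
      simp only
      rw [Real.sin_arcsin (by linarith [div_pos h0 hr]) hd.le]
      field_simp
  rw [intervalIntegral.integral_of_le hr.le, intervalIntegral.integral_of_le hpi,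
    integral_Ioc_eq_integral_Ioo, integral_Ioc_eq_integral_Ioo, ← himg,
    integral_image_eq_integral_abs_deriv_smul measurableSet_Ioo
      (fun φ _ => ((Real.hasDerivAt_sin φ).const_mul r).hasDerivWithinAt)
      (fun x hx y hy hxy => Real.injOn_sin (hsub hx) (hsub hy) (mul_left_cancel₀ hr.ne' hxy))]
  refine setIntegral_congr_fun measurableSet_Ioo fun φ hφ => ?_
  have hc : 0 < Real.cos φ := Real.cos_pos_of_mem_Ioo ⟨by linarith [hφ.1], hφ.2⟩
  simp only [smul_eq_mul]
  rw [abs_of_pos (mul_pos hr hc)]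

theorem sqrt_sq_sub_mul_sin_sq {r φ : ℝ} (hr : 0 ≤ r) (hφ : 0 ≤ Real.cos φ) :
    √(r ^ 2 - (r * Real.sin φ) ^ 2) = r * Real.cos φ := by
  rw [← Real.sqrt_sq (mul_nonneg hr hφ)]
  congr 1
  linear_combination (-r ^ 2) * Real.sin_sq_add_cos_sq φ

theorem cos_nonneg_of_mem_uIcc {φ : ℝ} (hφ : φ ∈ uIcc 0 (Real.pi / 2)) : 0 ≤ Real.cos φ := by
  rw [uIcc_of_le (by positivity)] at hφ
  exact Real.cos_nonneg_of_mem_Icc ⟨by linarith [hφ.1, Real.pi_pos], hφ.2⟩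

/-- The integral `roadExponent` in the variable `φ`, where `t = r sin φ`. -/
def roadExponentAngular (muB r : ℝ) : ℝ :=
  ∫ φ in (0 : ℝ)..(Real.pi / 2), r * Real.cos φ * (1 - Real.exp (-2 * muB * (r * Real.cos φ)))

theorem roadExponent_eq_angular (muB : ℝ) {r : ℝ} (hr : 0 ≤ r) :
    roadExponent muB r = roadExponentAngular muB r := by
  rcases hr.eq_or_lt with rfl | hr0
  · simp [roadExponent, roadExponentAngular]
  rw [roadExponent, intervalIntegral_comp_mul_sin hr0, roadExponentAngular]
  refine intervalIntegral.integral_congr fun φ hφ => ?_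
  rw [sqrt_sq_sub_mul_sin_sq hr (cos_nonneg_of_mem_uIcc hφ)]

theorem integral_density_factor (lamL muB : ℝ) {r : ℝ} (hr : 0 ≤ r) :
    ∫ u in (0 : ℝ)..r, 4 * lamL * muB * r * Real.exp (-2 * muB * √(r ^ 2 - u ^ 2)) / √(r ^ 2 - u ^ 2)
      = 2 * lamL * ∫ φ in (0 : ℝ)..(Real.pi / 2),
          2 * muB * r * Real.exp (-2 * muB * (r * Real.cos φ)) := by
  rcases hr.eq_or_lt with rfl | hr0
  · simp
  rw [intervalIntegral_comp_mul_sin hr0, ← intervalIntegral.integral_const_mul]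
  have hpi : (0 : ℝ) ≤ Real.pi / 2 := by positivity
  rw [intervalIntegral.integral_of_le hpi, intervalIntegral.integral_of_le hpi,
    integral_Ioc_eq_integral_Ioo, integral_Ioc_eq_integral_Ioo]
  refine setIntegral_congr_fun measurableSet_Ioo fun φ hφ => ?_
  have hc : 0 < Real.cos φ := Real.cos_pos_of_mem_Ioo ⟨by linarith [hφ.1], hφ.2⟩
  rw [sqrt_sq_sub_mul_sin_sq hr hc.le]
  field_simp
  ring

theorem integral_cos_mul_one_sub_exp (muB r : ℝ) :
    ∫ φ in (0 : ℝ)..(Real.pi / 2), Real.cos φ * (1 - Real.exp (-2 * muB * (r * Real.cos φ)))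
      = ∫ φ in (0 : ℝ)..(Real.pi / 2),
          Real.sin φ ^ 2 * (2 * muB * r * Real.exp (-2 * muB * (r * Real.cos φ))) := by
  have hder : ∀ φ, HasDerivAt (fun φ => 1 - Real.exp (-2 * muB * (r * Real.cos φ)))
      (-(Real.sin φ * (2 * muB * r * Real.exp (-2 * muB * (r * Real.cos φ))))) φ := fun φ => by
    have h := ((((Real.hasDerivAt_cos φ).const_mul r).const_mul (-2 * muB)).exp).const_sub 1
    refine h.congr_deriv ?_
    ring
  have h := intervalIntegral.integral_mul_deriv_eq_deriv_mul (a := 0) (b := Real.pi / 2)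
    (fun φ _ => hder φ) (fun φ _ => Real.hasDerivAt_sin φ)
    (Continuous.intervalIntegrable (by fun_prop) _ _)
    (Continuous.intervalIntegrable (by fun_prop) _ _)
  simp only [Real.cos_pi_div_two, Real.sin_zero, mul_zero, Real.exp_zero, sub_self, zero_mul,
    neg_mul, intervalIntegral.integral_neg, sub_neg_eq_add, zero_add] at h
  simp only [neg_mul]
  calc _ = _ := intervalIntegral.integral_congr fun φ _ => mul_comm _ _
    _ = _ := h
    _ = _ := intervalIntegral.integral_congr fun φ _ => by ring

theorem hasDerivAt_roadExponentAngular (muB r : ℝ) :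
    HasDerivAt (roadExponentAngular muB)
      (∫ φ in (0 : ℝ)..(Real.pi / 2), 2 * muB * r * Real.exp (-2 * muB * (r * Real.cos φ))) r := by
  let F' : ℝ → ℝ → ℝ := fun x φ => Real.cos φ * (1 - Real.exp (-2 * muB * (x * Real.cos φ)))
    + x * Real.cos φ * (2 * muB * Real.cos φ * Real.exp (-2 * muB * (x * Real.cos φ)))
  have hF'c : Continuous (Function.uncurry F') := by
    simp only [F', Function.uncurry_def]; fun_prop
  obtain ⟨C, hC⟩ := ((isCompact_closedBall r 1).prod
    (isCompact_uIcc (a := (0 : ℝ)) (b := Real.pi / 2))).exists_bound_of_continuousOn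
    hF'c.continuousOn
  have hder : ∀ x φ, HasDerivAt
      (fun x => x * Real.cos φ * (1 - Real.exp (-2 * muB * (x * Real.cos φ)))) (F' x φ) x := by
    intro x φ
    have h1 : HasDerivAt (fun x : ℝ => x * Real.cos φ) (Real.cos φ) x := by
      simpa using (hasDerivAt_id x).mul_const (Real.cos φ)
    have h2 := (((h1.const_mul (-2 * muB)).exp).const_sub 1)
    refine (h1.mul h2).congr_deriv ?_
    simp only [F']
    ring
  have h := (intervalIntegral.hasDerivAt_integral_of_dominated_loc_of_deriv_le (μ := volume)
    (a := 0) (b := Real.pi / 2) (x₀ := r) (s := Metric.closedBall r 1) (bound := fun _ => C)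
    (F := fun x φ => x * Real.cos φ * (1 - Real.exp (-2 * muB * (x * Real.cos φ)))) (F' := F')
    (Metric.closedBall_mem_nhds r one_pos)
    (Filter.Eventually.of_forall fun x => Continuous.aestronglyMeasurable (by fun_prop))
    (Continuous.intervalIntegrable (by fun_prop) _ _)
    (Continuous.aestronglyMeasurable (by simp only [F']; fun_prop))
    (Filter.Eventually.of_forall fun φ hφ x hx => hC (x, φ) ⟨hx, uIoc_subset_uIcc hφ⟩)
    (by simp)
    (Filter.Eventually.of_forall fun φ _ x _ => hder x φ)).2
  refine h.congr_deriv ?_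
  simp only [F']
  rw [intervalIntegral.integral_add (Continuous.intervalIntegrable (by fun_prop) _ _)
    (Continuous.intervalIntegrable (by fun_prop) _ _), integral_cos_mul_one_sub_exp,
    ← intervalIntegral.integral_add (Continuous.intervalIntegrable (by fun_prop) _ _)
    (Continuous.intervalIntegrable (by fun_prop) _ _)]
  refine intervalIntegral.integral_congr fun φ _ => ?_
  linear_combination (2 * muB * r * Real.exp (-2 * muB * (r * Real.cos φ)))
    * Real.sin_sq_add_cos_sq φ

/-- The probability density of the distance to the nearest base station. -/
def distanceDensity (lamB lamL muB r : ℝ) : ℝ :=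
  2 * Real.pi * lamB * r * Real.exp (-Real.pi * lamB * r ^ 2)
      * Real.exp (-2 * lamL * ∫ t in (0 : ℝ)..r, (1 - Real.exp (-2 * muB * √(r ^ 2 - t ^ 2))))
    + Real.exp (-Real.pi * lamB * r ^ 2
        - 2 * lamL * ∫ u in (0 : ℝ)..r, (1 - Real.exp (-2 * muB * √(r ^ 2 - u ^ 2))))
      * ∫ u in (0 : ℝ)..r,
          4 * lamL * muB * r * Real.exp (-2 * muB * √(r ^ 2 - u ^ 2)) / √(r ^ 2 - u ^ 2)

/-- The probability that there is no base station at distance less than `r`. -/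
def voidProbability (lamB lamL muB r : ℝ) : ℝ :=
  Real.exp (-Real.pi * lamB * r ^ 2 - 2 * lamL * roadExponentAngular muB r)

theorem hasDerivAt_voidProbability (lamB lamL muB : ℝ) {r : ℝ} (hr : 0 ≤ r) :
    HasDerivAt (fun r => -voidProbability lamB lamL muB r) (distanceDensity lamB lamL muB r) r := by
  have h := (((((hasDerivAt_id r).pow 2).const_mul (-Real.pi * lamB)).sub
    ((hasDerivAt_roadExponentAngular muB r).const_mul (2 * lamL))).exp).neg
  refine h.congr_deriv ?_
  rw [distanceDensity, integral_density_factor lamL muB hr]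
  change _ = _ * Real.exp (-2 * lamL * roadExponent muB r)
    + Real.exp (_ - 2 * lamL * roadExponent muB r) * _
  rw [roadExponent_eq_angular muB hr, mul_assoc _ (Real.exp _) (Real.exp _), ← Real.exp_add]
  simp only [Pi.sub_apply, Pi.pow_apply, id]
  rw [show -Real.pi * lamB * r ^ 2 + -2 * lamL * roadExponentAngular muB r
    = -Real.pi * lamB * r ^ 2 - 2 * lamL * roadExponentAngular muB r by ring]
  push_cast
  ring

theorem distanceDensity_nonneg {lamB lamL muB r : ℝ} (hB : 0 ≤ lamB) (hL : 0 ≤ lamL)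
    (hmu : 0 ≤ muB) (hr : 0 ≤ r) : 0 ≤ distanceDensity lamB lamL muB r := by
  refine add_nonneg (by positivity) (mul_nonneg (Real.exp_pos _).le ?_)
  exact intervalIntegral.integral_nonneg hr fun u _ => by positivity

theorem voidProbability_le {lamB lamL muB r : ℝ} (hL : 0 ≤ lamL) (hmu : 0 ≤ muB) (hr : 0 ≤ r) :
    voidProbability lamB lamL muB r ≤ Real.exp (-(Real.pi * lamB * r ^ 2)) := by
  refine Real.exp_le_exp.2 ?_
  rw [← roadExponent_eq_angular muB hr]
  have := mul_nonneg hL (roadExponent_nonneg hmu hr)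
  linarith

theorem tendsto_voidProbability {lamB lamL muB : ℝ} (hB : 0 < lamB) (hL : 0 ≤ lamL)
    (hmu : 0 ≤ muB) :
    Filter.Tendsto (voidProbability lamB lamL muB) Filter.atTop (nhds 0) := by
  refine tendsto_of_tendsto_of_tendsto_of_le_of_le' tendsto_const_nhds
    (h := fun r => Real.exp (-(Real.pi * lamB * r ^ 2))) ?_
    (Filter.Eventually.of_forall fun r => (Real.exp_pos _).le)
    (Filter.eventually_atTop.2 ⟨0, fun r hr => voidProbability_le hL hmu hr⟩)
  refine Real.tendsto_exp_neg_atTop_nhds_zero.comp ?_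
  exact (Filter.tendsto_pow_atTop two_ne_zero).const_mul_atTop (mul_pos Real.pi_pos hB)

theorem lintegral_distanceDensity {lamB lamL muB a : ℝ} (hB : 0 < lamB) (hL : 0 ≤ lamL)
    (hmu : 0 ≤ muB) (ha : 0 ≤ a) :
    ∫⁻ r in Ici a, ENNReal.ofReal (distanceDensity lamB lamL muB r)
      = ENNReal.ofReal (voidProbability lamB lamL muB a) := by
  have hd : ∀ x ∈ Ici a, HasDerivAt (fun r => -voidProbability lamB lamL muB r)
      (distanceDensity lamB lamL muB x) x := fun x hx =>
    hasDerivAt_voidProbability lamB lamL muB (ha.trans hx)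
  have hnn : ∀ x ∈ Ioi a, 0 ≤ distanceDensity lamB lamL muB x := fun x hx =>
    distanceDensity_nonneg hB.le hL hmu (ha.trans hx.le)
  have ht : Filter.Tendsto (fun r => -voidProbability lamB lamL muB r) Filter.atTop (nhds 0) := by
    simpa using (tendsto_voidProbability hB hL hmu).neg
  rw [setLIntegral_congr Ioi_ae_eq_Ici.symm, ← ofReal_integral_eq_lintegral_ofReal
    (integrableOn_Ioi_deriv_of_nonneg' hd hnn ht)
    ((ae_restrict_iff' measurableSet_Ioi).2 (Filter.Eventually.of_forall hnn)),
    integral_Ioi_of_hasDerivAt_of_nonneg' hd hnn ht]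
  simp

/-! ### The law of the distance to the nearest base station -/

namespace VehicularNetwork

variable {Ω : Type*} [MeasurableSpace Ω] {P : Measure Ω} {θ : Plane → Ω → Ω}
  {lamB lamU lamL muB : ℝ} (N : VehicularNetwork P θ lamB lamU lamL muB)

theorem measurable_R : Measurable N.R := by
  rw [show N.R = fun ω => min (N.Rp ω) (N.Rv ω) from funext N.R_eq_min]
  exact N.measurable_Rp'.min N.measurable_Rv'

theorem palm_le_R [IsProbabilityMeasure P] (hB : 0 < lamB) (hU : 0 < lamU) (hL : 0 < lamL)
    (hmu : 0 < muB) {r : ℝ} (hr : 0 ≤ r) :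
    palm P θ N.Φu {ω | ENNReal.ofReal r ≤ N.R ω}
      = ENNReal.ofReal (voidProbability lamB lamL muB r) := by
  have hm : Measurable fun ω => (N.Rp ω, N.Rv ω) := N.measurable_Rp'.prodMk N.measurable_Rv'
  have hS : MeasurableSet (Ici (ENNReal.ofReal r) ×ˢ Ici (ENNReal.ofReal r)) :=
    measurableSet_Ici.prod measurableSet_Ici
  have h1 : {ω | ENNReal.ofReal r ≤ N.R ω}
      = (fun ω => (N.Rp ω, N.Rv ω)) ⁻¹' (Ici (ENNReal.ofReal r) ×ˢ Ici (ENNReal.ofReal r)) := by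
    ext ω
    simp [N.R_eq_min]
  have h2 : (fun ω => (N.Rp ω, N.Rv ω)) ⁻¹' (Ici (ENNReal.ofReal r) ×ˢ Ici (ENNReal.ofReal r))
      = N.Rp ⁻¹' Ici (ENNReal.ofReal r) ∩ N.Rv ⁻¹' Ici (ENNReal.ofReal r) := rfl
  rw [h1, ← Measure.map_apply hm hS, N.map_palm_eq hU, Measure.map_apply hm hS, h2,
    N.indepFun_Rp_Rv.measure_inter_preimage_eq_mul _ _ measurableSet_Ici measurableSet_Ici]
  have h3 : P (N.Rp ⁻¹' Ici (ENNReal.ofReal r)) = _ := N.measure_le_Rp hB hr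
  have h4 : P (N.Rv ⁻¹' Ici (ENNReal.ofReal r)) = _ := N.measure_le_Rv hL hmu hr
  rw [h3, h4, ← ENNReal.ofReal_mul (Real.exp_pos _).le, ← Real.exp_add, voidProbability,
    roadExponent_eq_angular muB hr]
  congr 2
  ring

theorem palm_ae_R_lt_top [IsProbabilityMeasure P] (hB : 0 < lamB) (hU : 0 < lamU) (hL : 0 < lamL)
    (hmu : 0 < muB) : ∀ᵐ ω ∂palm P θ N.Φu, N.R ω < ∞ := by
  rw [ae_iff]
  have ht : Filter.Tendsto (fun r => ENNReal.ofReal (voidProbability lamB lamL muB r))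
      Filter.atTop (nhds 0) := by
    simpa using ENNReal.tendsto_ofReal (tendsto_voidProbability hB hL.le hmu.le)
  refine le_antisymm (ge_of_tendsto ht (Filter.eventually_atTop.2 ⟨0, fun r hr => ?_⟩)) zero_le
  rw [← N.palm_le_R hB hU hL hmu hr]
  refine measure_mono fun ω hω => ?_
  rw [mem_ofPred_eq, not_lt, top_le_iff] at hω
  rw [mem_ofPred_eq, hω]
  exact le_top

theorem map_toReal_R [IsProbabilityMeasure P] (hB : 0 < lamB) (hU : 0 < lamU) (hL : 0 < lamL)
    (hmu : 0 < muB) : (palm P θ N.Φu).map (fun ω => (N.R ω).toReal) =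
      (volume.restrict (Ici (0 : ℝ))).withDensity fun r =>
        ENNReal.ofReal (distanceDensity lamB lamL muB r) := by
  have := N.isProbabilityMeasure_palm hU
  refine Measure.ext_of_Ici _ _ fun a => ?_
  rw [Measure.map_apply N.measurable_R.ennreal_toReal measurableSet_Ici,
    withDensity_apply _ measurableSet_Ici, Measure.restrict_restrict measurableSet_Ici,
    Ici_inter_Ici, lintegral_distanceDensity hB hL.le hmu.le le_sup_right,
    ← N.palm_le_R hB hU hL hmu le_sup_right]
  refine measure_congr ?_
  filter_upwards [N.palm_ae_R_lt_top hB hU hL hmu] with ω hω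
  refine propext ?_
  change a ≤ (N.R ω).toReal ↔ ENNReal.ofReal (a ⊔ 0) ≤ N.R ω
  rw [ENNReal.ofReal_le_iff_le_toReal hω.ne, sup_le_iff]
  exact (and_iff_left ENNReal.toReal_nonneg).symm

end VehicularNetwork

end

theorem corollary1 {Ω : Type*} [MeasurableSpace Ω] (P : Measure Ω) [IsProbabilityMeasure P]
    (θ : Plane → Ω → Ω) (lamB lamU lamL muB : ℝ)
    (hB : 0 < lamB) (hU : 0 < lamU) (hL : 0 < lamL) (hmu : 0 < muB)
    (N : VehicularNetwork P θ lamB lamU lamL muB) :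
    IsProbabilityMeasure (palm P θ N.Φu) ∧
    (∀ ω, N.R ω = min (N.Rp ω) (N.Rv ω)) ∧
    IndepFun N.Rp N.Rv (palm P θ N.Φu) ∧
    (∀ᵐ ω ∂(palm P θ N.Φu), N.R ω < ∞) ∧
    (palm P θ N.Φu).map (fun ω => (N.R ω).toReal) =
      (volume.restrict (Set.Ici (0 : ℝ))).withDensity fun r => ENNReal.ofReal
        (2 * Real.pi * lamB * r * Real.exp (-Real.pi * lamB * r ^ 2)
            * Real.exp (-2 * lamL * ∫ t in (0 : ℝ)..r, (1 - Real.exp (-2 * muB * √(r ^ 2 - t ^ 2))))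
          + Real.exp (-Real.pi * lamB * r ^ 2
              - 2 * lamL * ∫ u in (0 : ℝ)..r, (1 - Real.exp (-2 * muB * √(r ^ 2 - u ^ 2))))
            * ∫ u in (0 : ℝ)..r,
                4 * lamL * muB * r * Real.exp (-2 * muB * √(r ^ 2 - u ^ 2)) / √(r ^ 2 - u ^ 2)) := by
  exact ⟨N.isProbabilityMeasure_palm hU, N.R_eq_min, N.indepFun_palm hU,
    N.palm_ae_R_lt_top hB hU hL hmu, N.map_toReal_R hB hU hL hmu⟩
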